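/- Fix integers $P\ge K$, reals $D,\lambda,\rho>0$, $\gamma\in[0,1]$, and angles $\theta_1,\dots,\theta_P\in[-\pi/2,\pi/2]$ such that $\frac D\lambda(\sin\theta_p-\sin\theta_q)\notin\mathbb Z$ for $p\ne q$. For $M\in\mathbb N$ let $\mathbf A\in\mathbb C^{M\times P}$ have the entries $\mathbf A_{(m,p)}=e^{-j2\pi m\frac D\lambda\sin\theta_p}$, $0\le m<M$, let $\mathbf G\in\mathbb C^{P\times K}$ have i.i.d. $\mathcal{CN}(0,1)$ entries, and let $\mathbf H=\frac1{\sqrt P}\mathbf A\mathbf G$. The received signal is $\mathbf y=\sqrt\rho\,\mathbf H\mathbf x+\mathbf w+\mathbf n$, where $\mathbf x\in\mathbb C^K$ is random with zero mean and covariance $\mathbf I_K$, $\mathbf n\sim\mathcal{CN}(0,\mathbf I_M)$, the variables $\mathbf x,\mathbf G,\mathbf n$ are independent, and $\mathbf w=\mathbf w^{(M)}\in\mathbb C^M$ is deterministic and vanishes outside a set $\Omega_M$ of at most $\gamma M$ faulty antennas. Write $\mathbf B^\dagger=(\mathbf B^*\mathbf B)^{-1}\mathbf B^*$. The limit $M\to\infty$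 is taken with $P,K,\gamma,\rho,D,\lambda,\theta_p$ fixed. (1) The ZF receiver $\widehat{\mathbf x}=\mathbf H^\dagger\mathbf y/\sqrt\rho$ satisfies asymptotically $$\mathbb E\|\mathbf x-\widehat{\mathbf x}\|_2\le\frac{\gamma P\,\|\mathbf w\|_\infty}{\sqrt\rho\,(\sqrt P-\sqrt K)}$$ if $P>K$ (for $P=K$ the right-hand side is read as $+\infty$); that is, for every $\varepsilon>0$ and all sufficiently large $M$, the left-hand side is at most the right-hand side plus $\varepsilon$. (2) Let $\gamma<1$, let $\overline{\mathbf H}$, $\overline{\mathbf A}$, $\overline{\mathbf y}$ be $\mathbf H$, $\mathbf A$, $\mathbf y$ with the rows (entries) in $\Omega_M$ removed, and let $\overline{\mathbf x}=\overline{\mathbf H}^\dagger\overline{\mathbf y}/\sqrt\rho$ be the modified ZF receiver. Then $\mathbb E\|\mathbf x-\overline{\mathbf x}\|_2\to0$ as $M\to\infty$, provided that at least one of the following holds: (a) for every $p$, $\gamma\cdot\#\{q:\frac D\lambda(\sin\theta_p-\sin\theta_q)\in\mathbb Q\}<1$ (in this case the sets $\Omega_M$ are otherwise arbitrary; the condition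 holds for instance for all $\gamma<1$ if the numbers $\frac D\lambda(\sin\theta_p-\sin\theta_q)$, $p\neq q$, are irrational, and for all angles as above if $\gamma<1/P$); (b) the surviving antennas satisfy $\frac{1}{M-|\Omega_M|}\overline{\mathbf A}^*\overline{\mathbf A}\to\mathbf I_P$. -/

import Mathlib

open MeasureTheory ProbabilityTheory Filter Topology
open scoped Matrix ComplexConjugate

noncomputable section

/-- The circularly symmetric standard complex Gaussian law `CN(0,1)`: real and imaginary parts are
independent real centred Gaussians of variance `1/2`. -/
def stdComplexGaussian : Measure ℂ :=
  ((gaussianReal 0 (1 / 2)).prod (gaussianReal 0 (1 / 2))).map Complex.measurableEquivRealProd.symm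

/-- A finite family of i.i.d. `CN(0,1)` random variables. -/
structure IsIIDStdComplexGaussian {Ω ι : Type*} [MeasurableSpace Ω] (μ : Measure Ω)
    (Z : ι → Ω → ℂ) : Prop where
  law : ∀ i, HasLaw (Z i) stdComplexGaussian μ
  indep : iIndepFun Z μ

/-- A random vector of `ℂ^K` with finite second moments, zero mean and identity covariance. -/
structure IsWhite {Ω : Type*} [MeasurableSpace Ω] (μ : Measure Ω) {K : ℕ}
    (x : Ω → Fin K → ℂ) : Prop where
  memLp : ∀ k, MemLp (fun ω => x ω k) 2 μ
  mean : ∀ k, ∫ ω, x ω k ∂μ = 0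
  cov : ∀ j k, ∫ ω, x ω j * conj (x ω k) ∂μ = if j = k then 1 else 0

/-- The random quantities of one uplink transmission: the transmitted vector `x` is white, the path
gains `G` and the noise `n` have i.i.d. `CN(0,1)` entries, and `x`, `G`, `n` are mutually
independent. -/
structure IsUplink {Ω : Type*} [MeasurableSpace Ω] (μ : Measure Ω) {M P K : ℕ}
    (x : Ω → Fin K → ℂ) (G : Ω → Fin P → Fin K → ℂ) (n : Ω → Fin M → ℂ) : Prop where
  signal : IsWhite μ x
  gains : IsIIDStdComplexGaussian μ (fun (pk : Fin P × Fin K) ω => G ω pk.1 pk.2)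
  noise : IsIIDStdComplexGaussian μ (fun m ω => n ω m)
  indep_gains_noise : IndepFun G n μ
  indep_signal : IndepFun x (fun ω => (G ω, n ω)) μ

/-- The `M × P` matrix whose columns are the steering vectors of a uniform linear array with
antenna spacing `D` and wave length `lam`, for the angles of arrival `θ`. -/
def steeringMatrix (D lam : ℝ) {P : ℕ} (θ : Fin P → ℝ) (M : ℕ) : Matrix (Fin M) (Fin P) ℂ :=
  Matrix.of fun m p =>
    Complex.exp (-(2 * Real.pi * ((m : ℕ) : ℂ) * (D / lam) * Real.sin (θ p)) * Complex.I)

/-- The finite scattering channel matrix `H = P^{-1/2} A G`. -/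
def channelMatrix (D lam : ℝ) {P K : ℕ} (θ : Fin P → ℝ) (M : ℕ) (g : Fin P → Fin K → ℂ) :
    Matrix (Fin M) (Fin K) ℂ :=
  ((Real.sqrt P : ℝ) : ℂ)⁻¹ • (steeringMatrix D lam θ M * Matrix.of g)

/-- The received signal `y = √ρ H x + w + n`. -/
def receivedSignal (ρ : ℝ) {M K : ℕ} (H : Matrix (Fin M) (Fin K) ℂ) (x : Fin K → ℂ)
    (w n : Fin M → ℂ) : Fin M → ℂ :=
  ((Real.sqrt ρ : ℝ) : ℂ) • (H *ᵥ x) + w + n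

/-- The zero-forcing pseudo-inverse `(H* H)⁻¹ H*`. -/
def zfInverse {m : Type*} [Fintype m] {K : ℕ} (H : Matrix m (Fin K) ℂ) : Matrix (Fin K) m ℂ :=
  (Hᴴ * H)⁻¹ * Hᴴ

/-- The zero-forcing estimate `H† y / √ρ` of the transmitted signal. -/
def zfEstimate (ρ : ℝ) {m : Type*} [Fintype m] {K : ℕ} (H : Matrix m (Fin K) ℂ) (y : m → ℂ) :
    Fin K → ℂ :=
  ((Real.sqrt ρ : ℝ) : ℂ)⁻¹ • (zfInverse H *ᵥ y)

/-- The matrix left after the rows indexed by `F` have been removed. -/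
def removeRows {M : ℕ} {k : Type*} (F : Finset (Fin M)) (A : Matrix (Fin M) k ℂ) :
    Matrix {m : Fin M // m ∉ F} k ℂ :=
  A.submatrix Subtype.val id

/-- The modified zero-forcing estimate: the readings of the antennas in `F` are discarded, and
zero forcing is applied to the remaining readings and rows of the channel matrix. -/
def modifiedZFEstimate (ρ : ℝ) {M K : ℕ} (F : Finset (Fin M)) (H : Matrix (Fin M) (Fin K) ℂ)
    (y : Fin M → ℂ) : Fin K → ℂ :=
  zfEstimate ρ (removeRows F H) (fun m => y m.val)

/-- The expected Euclidean detection error `E ‖x - x̂‖₂`, with values in `[0,∞]`. -/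
def detectionError {Ω : Type*} [MeasurableSpace Ω] (μ : Measure Ω) {K : ℕ}
    (x xhat : Ω → Fin K → ℂ) : ENNReal :=
  ∫⁻ ω, ‖WithLp.toLp 2 (x ω - xhat ω)‖ₑ ∂μ

/-- The detection error of the zero-forcing receiver. -/
def zfError {Ω : Type*} [MeasurableSpace Ω] (μ : Measure Ω) (D lam ρ : ℝ) {M P K : ℕ}
    (θ : Fin P → ℝ) (x : Ω → Fin K → ℂ) (G : Ω → Fin P → Fin K → ℂ) (w : Fin M → ℂ)
    (n : Ω → Fin M → ℂ) : ENNReal :=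
  detectionError μ x fun ω =>
    zfEstimate ρ (channelMatrix D lam θ M (G ω))
      (receivedSignal ρ (channelMatrix D lam θ M (G ω)) (x ω) w (n ω))

/-- The detection error of the zero-forcing receiver that discards the antennas in `F`. -/
def modifiedZFError {Ω : Type*} [MeasurableSpace Ω] (μ : Measure Ω) (D lam ρ : ℝ) {M P K : ℕ}
    (θ : Fin P → ℝ) (F : Finset (Fin M)) (x : Ω → Fin K → ℂ) (G : Ω → Fin P → Fin K → ℂ)
    (w : Fin M → ℂ) (n : Ω → Fin M → ℂ) : ENNReal :=
  detectionError μ x fun ω =>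
    modifiedZFEstimate ρ F (channelMatrix D lam θ M (G ω))
      (receivedSignal ρ (channelMatrix D lam θ M (G ω)) (x ω) w (n ω))

/-- The steering vectors restricted to the antennas outside `F M` are asymptotically
orthonormal: `(M - |F M|)⁻¹ Ā* Ā → I`. -/
def SurvivorsAsymptoticallyOrthogonal (D lam : ℝ) {P : ℕ} (θ : Fin P → ℝ)
    (F : (M : ℕ) → Finset (Fin M)) : Prop :=
  Tendsto
    (fun M : ℕ => (((M - (F M).card : ℝ) : ℂ))⁻¹ •
      ((removeRows (F M) (steeringMatrix D lam θ M))ᴴ *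
        removeRows (F M) (steeringMatrix D lam θ M)))
    atTop (𝓝 (1 : Matrix (Fin P) (Fin P) ℂ))

/-- The directions `q` whose spatial frequency `(D/lam) sin θ_q` differs from that of `p` by a
rational number (`p` itself included), i.e. those that are indistinguishable from `p` on some
infinite arithmetic progression of antennas. -/
def aliasClass (D lam : ℝ) {P : ℕ} (θ : Fin P → ℝ) (p : Fin P) : Set (Fin P) :=
  {q | ∃ r : ℚ, D / lam * (Real.sin (θ p) - Real.sin (θ q)) = r}

end

/-! For injective `H`, zero forcing recovers `x` up to the error `-ρ^{-1/2} H†(w + n)`, and `H† = √P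
(G* A*A G)⁻¹ G* A*`. So the array enters only through the `P × P` Gram matrix `A*A` and the vectors
`A*w`, `A*n`. If `A*A ≥ κM` as a quadratic form, then `(G* A*A G)⁻¹ G* v` has norm at most `‖G†‖_F
‖v‖ / (κM)` (`norm_weightedZF_mulVec_le`). The coordinates of `A*n` are of size `√M` and independent
of `G`, so the noise contributes `O(M^{-1/2}) E‖G†‖_F`.

This expectation is finite for `K ≤ P`: a row of `G†` is at most the inverse distance of a column of
`G` from the span of the others (`enorm_row_zfInverse_le`), and given the other columns this
distance dominates the norm of a Gaussian vector in dimension `P - K + 1`. For `K < P` the same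
argument gives `E‖G†‖_F² ≤ K / (P - K)`.

For the unmodified receiver, `A*A / M → I`, and `v = A*w / M` has norm at most `√P γ ‖w‖_∞`. Unitary
invariance improves the Frobenius bound to `E‖G†v‖ ≤ √(K / (P(P - K))) ‖v‖`. This constant lies
strictly below `1 / (√P - √K)`, and the gap absorbs the error of replacing `A*A / M` by `I`. That
error is proportional to `‖w‖_∞`, which may grow with `M`, so it could not be hidden in `ε`.

For the modified receiver only the noise is left, and it remains to bound the Gram matrix of the
surviving antennas below by `κM`. Asymptotic orthogonality gives this at once. Under the condition
on alias classes, a polynomial in the shift kills the `L - 1` other frequencies rationally related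
to that of `p`. What remains is an exponential sum that is small only on a sparse set
(`exists_card_small_exponential_sum_le`). As `γL < 1`, windows of `L` consecutive surviving antennas
have positive density, so the original sum cannot be small on almost all survivors
(`exists_mul_le_sum_norm_sq_exponential_sum`). -/

/-! ### Complex Gaussian vectors and their unitary invariance. -/

instance isProbabilityMeasure_stdComplexGaussian : IsProbabilityMeasure stdComplexGaussian :=
  Measure.isProbabilityMeasure_map (by fun_prop)
/-- The law of a vector of i.i.d. `CN(0,1)` variables. -/
noncomputable def complexGaussianVector (ι : Type*) [Fintype ι] : Measure (ι → ℂ) :=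
  Measure.pi fun _ : ι => stdComplexGaussian

instance isProbabilityMeasure_complexGaussianVector (ι : Type*) [Fintype ι] :
    IsProbabilityMeasure (complexGaussianVector ι) := by
  unfold complexGaussianVector; infer_instance

theorem integral_stdComplexGaussian {E : Type*} [NormedAddCommGroup E] [NormedSpace ℝ E]
    (f : ℂ → E) : ∫ z, f z ∂stdComplexGaussian =
      ∫ p : ℝ × ℝ, f ⟨p.1, p.2⟩ ∂((gaussianReal 0 (1 / 2)).prod (gaussianReal 0 (1 / 2))) := by
  rw [stdComplexGaussian, integral_map_equiv]; rfl

theorem charFun_stdComplexGaussian (t : ℂ) :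
    charFun stdComplexGaussian t = Complex.exp (-(‖t‖ ^ 2 : ℝ) / 4) := by
  rw [charFun_apply, integral_stdComplexGaussian]
  have h : ∀ p : ℝ × ℝ, Complex.exp ((inner ℝ (⟨p.1, p.2⟩ : ℂ) t : ℝ) * Complex.I) =
      Complex.exp ((t.re * p.1 : ℝ) * Complex.I) * Complex.exp ((t.im * p.2 : ℝ) * Complex.I) := by
    intro p
    rw [← Complex.exp_add, Complex.inner, ← add_mul]
    congr 2
    simp only [Complex.mul_re, Complex.conj_re, Complex.conj_im]
    push_cast; ring
  simp_rw [h]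
  rw [integral_prod_mul (fun x : ℝ => Complex.exp ((t.re * x : ℝ) * Complex.I))
    (fun x : ℝ => Complex.exp ((t.im * x : ℝ) * Complex.I))]
  have key : ∀ s : ℝ, ∫ x, Complex.exp ((s * x : ℝ) * Complex.I) ∂(gaussianReal 0 (1 / 2)) =
      Complex.exp (-(s ^ 2 : ℝ) / 4) := by
    intro s
    have := charFun_gaussianReal (μ := 0) (v := 1 / 2) s
    rw [charFun_apply_real] at this
    rw [show (fun x : ℝ => Complex.exp ((s * x : ℝ) * Complex.I)) =
      fun x : ℝ => Complex.exp (s * x * Complex.I) by ext; push_cast; rfl, this]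
    congr 1
    push_cast; ring
  rw [key, key, ← Complex.exp_add, ← Complex.normSq_eq_norm_sq, Complex.normSq_apply]
  congr 1
  push_cast; ring

/-- The characteristic function depends on `t` only through its norm; this is the source of unitary
invariance. -/
theorem charFun_complexGaussianVector {ι : Type*} [Fintype ι] (t : EuclideanSpace ℂ ι) :
    charFun ((complexGaussianVector ι).map (WithLp.toLp 2)) t =
      Complex.exp (-(‖t‖ ^ 2 : ℝ) / 4) := by
  rw [complexGaussianVector, charFun_pi]
  simp_rw [charFun_stdComplexGaussian]
  rw [← Complex.exp_sum, EuclideanSpace.norm_sq_eq]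
  congr 1
  push_cast
  rw [← Finset.sum_div, Finset.sum_neg_distrib]

/-- The law of an i.i.d. `CN(0,1)` vector is invariant under unitary maps. -/
theorem complexGaussianVector_map_unitary {ι : Type*} [Fintype ι]
    (U : EuclideanSpace ℂ ι ≃ₗᵢ[ℂ] EuclideanSpace ℂ ι) :
    MeasurePreserving (fun g : ι → ℂ => WithLp.ofLp (U (WithLp.toLp 2 g)))
      (complexGaussianVector ι) (complexGaussianVector ι) := by
  have hm : Measurable (fun g : ι → ℂ => WithLp.ofLp (U (WithLp.toLp 2 g))) := by
    have : Continuous U := U.continuous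
    fun_prop
  refine ⟨hm, ?_⟩
  have : IsProbabilityMeasure ((complexGaussianVector ι).map
    (fun g : ι → ℂ => WithLp.ofLp (U (WithLp.toLp 2 g)))) :=
    Measure.isProbabilityMeasure_map hm.aemeasurable
  refine charFun_eq_pi_iff.1 fun t => ?_
  have ht := charFun_complexGaussianVector (ι := ι) t
  have hs := charFun_complexGaussianVector (ι := ι) (U.symm t)
  rw [complexGaussianVector, charFun_pi] at ht
  rw [ht, ← U.symm.norm_map t, ← hs, charFun_apply, charFun_apply,
    Measure.map_map (by fun_prop) hm, integral_map (by fun_prop) (by fun_prop),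
    integral_map (by fun_prop) (by fun_prop)]
  refine integral_congr_ae (Eventually.of_forall fun g => ?_)
  -- Characteristic functions use the real inner product; as the real part of the complex one it is
  -- preserved by `U`.
  have e : ∀ a b : EuclideanSpace ℂ ι, inner ℝ a b = RCLike.re (inner ℂ a b) := by
    intro a b
    simp [PiLp.inner_apply, Complex.inner, mul_comm]
  simp only [Function.comp, WithLp.toLp_ofLp]
  rw [e, e, ← U.inner_map_map (WithLp.toLp 2 g), U.apply_symm_apply]

/-! ### Inverse moments of the norm of a Gaussian vector. -/

theorem integral_exp_neg_mul_sq_gaussianReal_half {t : ℝ} (ht : 0 ≤ t) :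
    ∫ x, Real.exp (-t * x ^ 2) ∂(gaussianReal 0 (1 / 2)) = (Real.sqrt (1 + t))⁻¹ := by
  rw [integral_gaussianReal_eq_integral_smul (by norm_num)]
  have h : ∀ x : ℝ, gaussianPDFReal 0 (1 / 2) x • Real.exp (-t * x ^ 2) =
      (Real.sqrt Real.pi)⁻¹ * Real.exp (-(1 + t) * x ^ 2) := by
    intro x
    rw [gaussianPDFReal, smul_eq_mul, mul_assoc, ← Real.exp_add]
    congr 2
    · congr 1; push_cast; ring
    · push_cast; ring
  simp_rw [h]
  rw [integral_const_mul, integral_gaussian, Real.sqrt_div Real.pi_pos.le]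
  have : Real.sqrt Real.pi ≠ 0 := by positivity
  field_simp

theorem integral_exp_neg_mul_norm_sq_stdComplexGaussian {t : ℝ} (ht : 0 ≤ t) :
    ∫ z, Real.exp (-t * ‖z‖ ^ 2) ∂stdComplexGaussian = (1 + t)⁻¹ := by
  rw [integral_stdComplexGaussian]
  have h : ∀ p : ℝ × ℝ, Real.exp (-t * ‖(⟨p.1, p.2⟩ : ℂ)‖ ^ 2) =
      Real.exp (-t * p.1 ^ 2) * Real.exp (-t * p.2 ^ 2) := by
    intro p
    rw [← Complex.normSq_eq_norm_sq, Complex.normSq_mk, ← Real.exp_add]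
    congr 1; ring
  simp_rw [h]
  rw [integral_prod_mul (fun x : ℝ => Real.exp (-t * x ^ 2))
    (fun x : ℝ => Real.exp (-t * x ^ 2)), integral_exp_neg_mul_sq_gaussianReal_half ht,
    ← mul_inv, Real.mul_self_sqrt (by linarith)]

/-- Inverse powers of the norm are integrals of such exponentials, so this Laplace transform yields
their means by Tonelli. -/
theorem lintegral_exp_neg_mul_sum_norm_sq {ι : Type*} [Fintype ι] (s : Finset ι) {t : ℝ}
    (ht : 0 ≤ t) :
    ∫⁻ g, ENNReal.ofReal (Real.exp (-t * ∑ i ∈ s, ‖g i‖ ^ 2)) ∂(complexGaussianVector ι) =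
      ENNReal.ofReal (((1 + t) ^ s.card)⁻¹) := by
  classical
  rw [← ofReal_integral_eq_lintegral_ofReal]
  · congr 1
    have h : ∀ g : ι → ℂ, Real.exp (-t * ∑ i ∈ s, ‖g i‖ ^ 2) =
        ∏ i, if i ∈ s then Real.exp (-t * ‖g i‖ ^ 2) else 1 := by
      intro g
      rw [Finset.prod_ite_mem, Finset.univ_inter, ← Real.exp_sum, Finset.mul_sum]
    simp_rw [h]
    rw [complexGaussianVector,
      integral_fintype_prod_eq_prod (f := fun i (z : ℂ) => if i ∈ s then
        Real.exp (-t * ‖z‖ ^ 2) else 1)]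
    have h2 : ∀ i : ι, ∫ z : ℂ, (if i ∈ s then Real.exp (-t * ‖z‖ ^ 2) else 1)
        ∂stdComplexGaussian = if i ∈ s then (1 + t)⁻¹ else 1 := by
      intro i
      split_ifs
      · exact integral_exp_neg_mul_norm_sq_stdComplexGaussian ht
      · simp
    simp_rw [h2]
    rw [Finset.prod_ite_mem, Finset.univ_inter, Finset.prod_const, inv_pow]
  · refine Integrable.of_bound (Measurable.aestronglyMeasurable (by fun_prop)) 1 (Eventually.of_forall fun g => ?_)
    rw [Real.norm_eq_abs, abs_of_pos (Real.exp_pos _), Real.exp_le_one_iff]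
    have : 0 ≤ ∑ i ∈ s, ‖g i‖ ^ 2 := by positivity
    nlinarith
  · exact Eventually.of_forall fun g => (Real.exp_pos _).le

/-- Stated in `ENNReal` so that it also holds at `r = 0`, where both sides are `⊤`. -/
theorem inv_sq_le_lintegral_exp (r : ℝ) :
    (ENNReal.ofReal (r ^ 2))⁻¹ ≤ ∫⁻ t in Set.Ioi (0 : ℝ), ENNReal.ofReal (Real.exp (-t * r ^ 2)) := by
  rcases (sq_nonneg r).eq_or_lt with h | h
  · simp [← h]
  · rw [← ofReal_integral_eq_lintegral_ofReal]
    · have := integral_exp_mul_Ioi (neg_lt_zero.2 h) 0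
      rw [← ENNReal.ofReal_inv_of_pos h]
      refine ENNReal.ofReal_le_ofReal (le_of_eq ?_)
      simp_rw [show ∀ t : ℝ, -t * r ^ 2 = -(r ^ 2) * t by intro t; ring]
      rw [this]
      simp
    · have := integrableOn_exp_mul_Ioi (neg_lt_zero.2 h) 0
      simp_rw [show ∀ t : ℝ, -t * r ^ 2 = -(r ^ 2) * t by intro t; ring]
      exact this
    · exact Eventually.of_forall fun g => (Real.exp_pos _).le

theorem inv_le_lintegral_exp_sq {r : ℝ} (hr : 0 ≤ r) :
    (ENNReal.ofReal r)⁻¹ ≤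
      ∫⁻ t : ℝ, ENNReal.ofReal (Real.exp (-t ^ 2 * r ^ 2)) := by
  rcases hr.eq_or_lt with h | h
  · simp [← h]
  · have h2 : 0 < r ^ 2 := by positivity
    simp_rw [show ∀ t : ℝ, -t ^ 2 * r ^ 2 = -(r ^ 2) * t ^ 2 by intro t; ring]
    rw [← ofReal_integral_eq_lintegral_ofReal (integrable_exp_neg_mul_sq h2)
      (Eventually.of_forall fun g => (Real.exp_pos _).le), integral_gaussian,
      ← ENNReal.ofReal_inv_of_pos h]
    refine ENNReal.ofReal_le_ofReal (Real.le_sqrt_of_sq_le ?_)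
    rw [div_eq_mul_inv, inv_pow]
    exact le_mul_of_one_le_left (by positivity) (by linarith [Real.pi_gt_three])

/-- Writing `1/r = ∫ exp(-tr) dt` reduces the mean to `∫ (1+t)^(-s) dt` over `t > 0`, with `s` the
number of coordinates. -/
theorem lintegral_inv_sum_norm_sq_le {ι : Type*} [Fintype ι] (s : Finset ι) (hs : 2 ≤ s.card) :
    ∫⁻ g, (ENNReal.ofReal (∑ i ∈ s, ‖g i‖ ^ 2))⁻¹ ∂(complexGaussianVector ι) ≤
      ENNReal.ofReal (1 / (s.card - 1)) := by
  have hpos : ∀ g : ι → ℂ, 0 ≤ ∑ i ∈ s, ‖g i‖ ^ 2 := fun g => by positivity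
  calc _ ≤ ∫⁻ g : ι → ℂ, (∫⁻ t in Set.Ioi (0 : ℝ),
        ENNReal.ofReal (Real.exp (-t * ∑ i ∈ s, ‖g i‖ ^ 2))) ∂(complexGaussianVector ι) := by
        refine lintegral_mono fun g => ?_
        have := inv_sq_le_lintegral_exp (Real.sqrt (∑ i ∈ s, ‖g i‖ ^ 2))
        rwa [Real.sq_sqrt (hpos g)] at this
    _ = ∫⁻ t in Set.Ioi (0 : ℝ), ∫⁻ g,
        ENNReal.ofReal (Real.exp (-t * ∑ i ∈ s, ‖g i‖ ^ 2)) ∂(complexGaussianVector ι) :=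
        lintegral_lintegral_swap (Measurable.aemeasurable (by fun_prop))
    _ = ∫⁻ t in Set.Ioi (0 : ℝ), ENNReal.ofReal (((1 + t) ^ s.card)⁻¹) :=
        setLIntegral_congr_fun measurableSet_Ioi fun t ht =>
          lintegral_exp_neg_mul_sum_norm_sq s (le_of_lt ht)
    _ = ∫⁻ t in Set.Ioi (1 : ℝ), ENNReal.ofReal (t ^ (-(s.card : ℝ))) := by
        have := (measurePreserving_add_left (volume : Measure ℝ) 1).setLIntegral_comp_preimage_emb
          (measurableEmbedding_addLeft 1) (fun t => ENNReal.ofReal (t ^ (-(s.card : ℝ))))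
          (Set.Ioi 1)
        rw [← this, Set.preimage_const_add_Ioi, sub_self]
        refine setLIntegral_congr_fun measurableSet_Ioi fun t ht => ?_
        have ht : (0 : ℝ) < t := ht
        rw [Real.rpow_neg (by linarith), Real.rpow_natCast]
    _ ≤ _ := by
        have hc : (2 : ℝ) ≤ s.card := by exact_mod_cast hs
        rw [← ofReal_integral_eq_lintegral_ofReal
          (integrableOn_Ioi_rpow_of_lt (by linarith) one_pos)]
        · rw [integral_Ioi_rpow_of_lt (by linarith) one_pos]
          refine ENNReal.ofReal_le_ofReal (le_of_eq ?_)
          rw [Real.one_rpow, neg_div, ← div_neg]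
          congr 1; ring
        · filter_upwards [ae_restrict_mem measurableSet_Ioi] with t ht
          have ht : (1 : ℝ) < t := ht
          simp only [Pi.zero_apply]
          positivity

/-- The first inverse moment is finite even for a single coordinate, where the second is not; this
is what the square case `K = P` needs. -/
theorem lintegral_inv_sqrt_sum_norm_sq_le {ι : Type*} [Fintype ι] (s : Finset ι)
    (hs : 1 ≤ s.card) :
    ∫⁻ g, (ENNReal.ofReal (Real.sqrt (∑ i ∈ s, ‖g i‖ ^ 2)))⁻¹ ∂(complexGaussianVector ι) ≤
      ENNReal.ofReal Real.pi := by
  have hpos : ∀ g : ι → ℂ, 0 ≤ ∑ i ∈ s, ‖g i‖ ^ 2 := fun g => by positivity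
  calc _ ≤ ∫⁻ g : ι → ℂ, (∫⁻ t : ℝ,
        ENNReal.ofReal (Real.exp (-t ^ 2 * ∑ i ∈ s, ‖g i‖ ^ 2))) ∂(complexGaussianVector ι) := by
        refine lintegral_mono fun g => ?_
        have := inv_le_lintegral_exp_sq (Real.sqrt_nonneg (∑ i ∈ s, ‖g i‖ ^ 2))
        rwa [Real.sq_sqrt (hpos g)] at this
    _ = ∫⁻ t : ℝ, ∫⁻ g,
        ENNReal.ofReal (Real.exp (-t ^ 2 * ∑ i ∈ s, ‖g i‖ ^ 2)) ∂(complexGaussianVector ι) :=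
        lintegral_lintegral_swap (Measurable.aemeasurable (by fun_prop))
    _ ≤ ∫⁻ t : ℝ, ENNReal.ofReal ((1 + t ^ 2)⁻¹) := by
        refine lintegral_mono fun t => ?_
        rw [lintegral_exp_neg_mul_sum_norm_sq s (sq_nonneg t)]
        refine ENNReal.ofReal_le_ofReal (inv_anti₀ (by positivity) ?_)
        -- Keeping a single factor of `(1 + t²)^s` leaves the integral of `1/(1 + t²)`, which is `π`
        -- whatever the dimension.
        exact le_self_pow₀ (by nlinarith [sq_nonneg t]) (by omega)
    _ = _ := by
        rw [← ofReal_integral_eq_lintegral_ofReal integrable_inv_one_add_sq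
          (Eventually.of_forall fun t => by positivity), integral_univ_inv_one_add_sq]

theorem lintegral_enorm_stdComplexGaussian_lt_top :
    ∫⁻ z, ‖z‖ₑ ∂stdComplexGaussian < ⊤ := by
  rw [stdComplexGaussian, lintegral_map (by fun_prop) (by fun_prop)]
  have hi : Integrable (fun x : ℝ => x) (gaussianReal 0 (1 / 2)) :=
    (memLp_id_gaussianReal 1).integrable le_rfl
  have h : Integrable (fun p : ℝ × ℝ => |p.1| + |p.2|)
      ((gaussianReal 0 (1 / 2)).prod (gaussianReal 0 (1 / 2))) :=
    (hi.abs.comp_fst _).add (hi.abs.comp_snd _)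
  refine lt_of_le_of_lt (lintegral_mono fun p => ?_) h.2
  rw [← ofReal_norm, ← ofReal_norm]
  refine ENNReal.ofReal_le_ofReal ((Complex.norm_le_abs_re_add_abs_im _).trans ?_)
  exact le_abs_self _

/-! ### Distance of a Gaussian column from the span of the others. -/

/-- Tonelli in the coordinate `k`: a bound uniform in the frozen coordinates survives averaging over
them. -/
theorem lintegral_pi_le_of_update {κ X : Type*} [Fintype κ] [DecidableEq κ] [MeasurableSpace X]
    (μ : Measure X) [IsProbabilityMeasure μ] {f : (κ → X) → ENNReal} (hf : Measurable f) (k : κ)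
    {C : ENNReal} (h : ∀ x, ∫⁻ y, f (Function.update x k y) ∂μ ≤ C) :
    ∫⁻ x, f x ∂(Measure.pi fun _ : κ => μ) ≤ C := by
  have h0 : Nonempty X := μ.nonempty_of_neZero
  obtain ⟨x0⟩ : Nonempty (κ → X) := inferInstance
  rw [lintegral_eq_lmarginal_univ x0, lmarginal_erase' f hf (Finset.mem_univ k)]
  calc _ ≤ (lmarginal (fun _ : κ => μ) (Finset.univ.erase k) fun _ => C) x0 :=
        lmarginal_mono (fun x => h x) x0
    _ = C := by simp [lmarginal]

/-- The distance of the vector `g k` from the span of the other vectors of the family `g`. -/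
noncomputable def distSpanOthers {κ ι : Type*} [Fintype κ] [DecidableEq κ] [Fintype ι] (k : κ)
    (g : κ → ι → ℂ) : ENNReal :=
  ⨅ a : κ → ℂ, ‖WithLp.toLp 2 (g k - ∑ j ∈ Finset.univ.erase k, a j • g j)‖ₑ

section
variable {κ ι : Type*} [Fintype κ] [DecidableEq κ] [Fintype ι]

/-- The infimum is over an uncountable family, but each member is continuous in `g`, so strict
sublevel sets are unions of open sets. -/
theorem measurable_distSpanOthers (k : κ) :
    Measurable (distSpanOthers k : (κ → ι → ℂ) → ENNReal) := by
  refine measurable_of_Iio fun c => IsOpen.measurableSet ?_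
  have : (distSpanOthers k : (κ → ι → ℂ) → ENNReal) ⁻¹' Set.Iio c = ⋃ a : κ → ℂ,
      {g : κ → ι → ℂ | ‖WithLp.toLp 2 (g k - ∑ j ∈ Finset.univ.erase k, a j • g j)‖ₑ < c} := by
    ext g
    simp [distSpanOthers, iInf_lt_iff]
  rw [this]
  refine isOpen_iUnion fun a => isOpen_lt ?_ continuous_const
  fun_prop

theorem exists_orthonormalBasis_orthogonal_to_subspace (S : Submodule ℂ (EuclideanSpace ℂ ι)) {r : ℕ}
    (hS : Module.finrank ℂ S ≤ r) (hr : r ≤ Fintype.card ι) :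
    ∃ (b : OrthonormalBasis ι ℂ (EuclideanSpace ℂ ι)) (s : Finset ι),
      s.card = Fintype.card ι - r ∧ ∀ i ∈ s, ∀ v ∈ S, inner ℂ (b i) v = 0 := by
  classical
  obtain ⟨s, -, hs⟩ := Finset.exists_subset_card_eq
    (s := (Finset.univ : Finset ι)) (n := Fintype.card ι - r) (by simp)
  have hfr : Module.finrank ℂ S + Module.finrank ℂ Sᗮ = Fintype.card ι := by
    rw [S.finrank_add_finrank_orthogonal, finrank_euclideanSpace]
  obtain ⟨e⟩ : Nonempty (s ↪ Fin (Module.finrank ℂ Sᗮ)) :=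
    Function.Embedding.nonempty_of_card_le (by simp; omega)
  let v : ι → EuclideanSpace ℂ ι := fun i =>
    if h : i ∈ s then (stdOrthonormalBasis ℂ Sᗮ (e ⟨i, h⟩) : EuclideanSpace ℂ ι) else 0
  have hv : Orthonormal ℂ ((s : Set ι).domRestrict v) := by
    have h1 : Orthonormal ℂ (fun i : s => (stdOrthonormalBasis ℂ Sᗮ (e i) : EuclideanSpace ℂ ι)) :=
      ((stdOrthonormalBasis ℂ Sᗮ).orthonormal.comp_linearIsometry Sᗮ.subtypeₗᵢ).comp _ e.injective
    have h2 : (s : Set ι).domRestrict v =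
        fun i : s => (stdOrthonormalBasis ℂ Sᗮ (e i) : EuclideanSpace ℂ ι) :=
      funext fun i => dif_pos i.2
    rw [h2]
    exact h1
  obtain ⟨b, hb⟩ := hv.exists_orthonormalBasis_extension_of_card_eq (by simp)
  refine ⟨b, s, hs, fun i hi w hw => ?_⟩
  rw [hb i hi]
  simp only [v, hi, dif_pos]
  exact Submodule.inner_left_of_mem_orthogonal hw (Submodule.coe_mem _)

/-- The other columns span at most `card κ - 1` dimensions. Coordinates orthogonal to this span are
untouched by subtracting a combination of them, so they bound the distance below. -/
theorem exists_orthonormalBasis_le_distSpanOthers (k : κ) (hcard : Fintype.card κ ≤ Fintype.card ι)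
    (x : κ → ι → ℂ) :
    ∃ (b : OrthonormalBasis ι ℂ (EuclideanSpace ℂ ι)) (s : Finset ι),
      s.card + Fintype.card κ = Fintype.card ι + 1 ∧
      ∀ y, ENNReal.ofReal (Real.sqrt (∑ i ∈ s, ‖b.repr (WithLp.toLp 2 y) i‖ ^ 2)) ≤
        distSpanOthers k (Function.update x k y) := by
  have hk : 1 ≤ Fintype.card κ := Fintype.card_pos_iff.2 ⟨k⟩
  let S : Submodule ℂ (EuclideanSpace ℂ ι) :=
    Submodule.span ℂ ((Finset.univ.erase k).image fun j => WithLp.toLp 2 (x j) : Finset _)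
  have hS : Module.finrank ℂ S ≤ Fintype.card κ - 1 := by
    refine (finrank_span_finset_le_card _).trans (Finset.card_image_le.trans ?_)
    rw [Finset.card_erase_of_mem (Finset.mem_univ k), Finset.card_univ]
  obtain ⟨b, s, hs, hbs⟩ := exists_orthonormalBasis_orthogonal_to_subspace S hS (by omega)
  refine ⟨b, s, by omega, fun y => le_iInf fun a => ?_⟩
  rw [← ofReal_norm]
  refine ENNReal.ofReal_le_ofReal (Real.sqrt_le_iff.2 ⟨norm_nonneg _, ?_⟩)
  rw [← b.repr.norm_map, EuclideanSpace.norm_sq_eq]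
  refine le_trans (le_of_eq ?_) (Finset.sum_le_univ_sum_of_nonneg (s := s) fun i => by positivity)
  refine Finset.sum_congr rfl fun i hi => ?_
  congr 2
  rw [b.repr_apply_apply, b.repr_apply_apply, Function.update_self, WithLp.toLp_sub, inner_sub_right,
    WithLp.toLp_sum, inner_sum, Finset.sum_eq_zero, sub_zero]
  intro j hj
  rw [Function.update_of_ne (Finset.ne_of_mem_erase hj), WithLp.toLp_smul, inner_smul_right,
    hbs i hi _ (Submodule.subset_span (by simpa using ⟨j, (Finset.ne_of_mem_erase hj), rfl⟩)), mul_zero]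

/-- With the other columns frozen, the basis depends only on them, and by unitary invariance the
coordinates of column `k` in it are again i.i.d. Gaussian; at least one of them is orthogonal to the
span. -/
theorem lintegral_inv_distSpanOthers_le (k : κ) (hcard : Fintype.card κ ≤ Fintype.card ι) :
    ∫⁻ g, (distSpanOthers k g)⁻¹ ∂(Measure.pi fun _ : κ => complexGaussianVector ι) ≤
      ENNReal.ofReal Real.pi := by
  refine lintegral_pi_le_of_update _ (measurable_distSpanOthers k).inv k fun x => ?_
  obtain ⟨b, s, hs, h⟩ := exists_orthonormalBasis_le_distSpanOthers k hcard x
  refine le_trans (lintegral_mono fun y => ENNReal.inv_le_inv.2 (h y)) ?_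
  rw [(complexGaussianVector_map_unitary b.repr).lintegral_comp
    (f := fun g => (ENNReal.ofReal (Real.sqrt (∑ i ∈ s, ‖g i‖ ^ 2)))⁻¹)
    (Measurable.inv (by fun_prop))]
  exact lintegral_inv_sqrt_sum_norm_sq_le s (by omega)

theorem lintegral_inv_distSpanOthers_sq_le (k : κ) (hcard : Fintype.card κ < Fintype.card ι) :
    ∫⁻ g, (distSpanOthers k g ^ 2)⁻¹ ∂(Measure.pi fun _ : κ => complexGaussianVector ι) ≤
      ENNReal.ofReal (1 / (Fintype.card ι - Fintype.card κ)) := by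
  refine lintegral_pi_le_of_update _ ((measurable_distSpanOthers k).pow_const 2).inv k fun x => ?_
  obtain ⟨b, s, hs, h⟩ := exists_orthonormalBasis_le_distSpanOthers k hcard.le x
  refine le_trans (lintegral_mono fun y =>
    ENNReal.inv_le_inv.2 (pow_le_pow_left' (h y) 2)) ?_
  simp_rw [← ENNReal.ofReal_pow (Real.sqrt_nonneg _)]
  rw [(complexGaussianVector_map_unitary b.repr).lintegral_comp
    (f := fun g => (ENNReal.ofReal (Real.sqrt (∑ i ∈ s, ‖g i‖ ^ 2) ^ 2))⁻¹)
    (Measurable.inv (by fun_prop))]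
  have hc : (s.card : ℝ) - 1 = Fintype.card ι - Fintype.card κ := by
    have : (s.card : ℝ) + Fintype.card κ = Fintype.card ι + 1 := by exact_mod_cast hs
    linarith
  rw [← hc]
  have hsq : ∀ g : ι → ℂ, Real.sqrt (∑ i ∈ s, ‖g i‖ ^ 2) ^ 2 = ∑ i ∈ s, ‖g i‖ ^ 2 :=
    fun g => Real.sq_sqrt (by positivity)
  simp_rw [hsq]
  exact lintegral_inv_sum_norm_sq_le s (by omega)

theorem ae_distSpanOthers_ne_zero (hcard : Fintype.card κ ≤ Fintype.card ι) :
    ∀ᵐ g ∂(Measure.pi fun _ : κ => complexGaussianVector ι), ∀ k, distSpanOthers k g ≠ 0 := by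
  refine ae_all_iff.2 fun k => ?_
  filter_upwards [ae_lt_top (measurable_distSpanOthers k).inv
    (ne_top_of_le_ne_top ENNReal.ofReal_ne_top (lintegral_inv_distSpanOthers_le k hcard))] with g hg
  simpa using hg.ne
end

/-! ### Deterministic bounds for the weighted pseudo-inverse. -/

/-- The Frobenius norm of a matrix. -/
noncomputable def frobNorm {m n : Type*} [Fintype m] [Fintype n] (A : Matrix m n ℂ) : ℝ :=
  Real.sqrt (∑ i, ∑ j, ‖A i j‖ ^ 2)

theorem frobNorm_nonneg {m n : Type*} [Fintype m] [Fintype n] (A : Matrix m n ℂ) :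
    0 ≤ frobNorm A := Real.sqrt_nonneg _

theorem frobNorm_sq {m n : Type*} [Fintype m] [Fintype n] (A : Matrix m n ℂ) :
    frobNorm A ^ 2 = ∑ i, ∑ j, ‖A i j‖ ^ 2 := Real.sq_sqrt (by positivity)

theorem norm_mulVec_le_frobNorm {m n : Type*} [Fintype m] [Fintype n] (A : Matrix m n ℂ)
    (v : n → ℂ) : ‖WithLp.toLp 2 (A *ᵥ v)‖ ≤ frobNorm A * ‖WithLp.toLp 2 v‖ := by
  refine le_of_sq_le_sq ?_ (mul_nonneg (frobNorm_nonneg _) (norm_nonneg _))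
  rw [mul_pow, frobNorm_sq, EuclideanSpace.norm_sq_eq, EuclideanSpace.norm_sq_eq, Finset.sum_mul]
  refine Finset.sum_le_sum fun i _ => ?_
  calc ‖(A *ᵥ v) i‖ ^ 2 ≤ (∑ j, ‖A i j‖ * ‖v j‖) ^ 2 := by
        refine pow_le_pow_left₀ (norm_nonneg _) ?_ 2
        exact (norm_sum_le _ _).trans (le_of_eq (by simp))
    _ ≤ _ := Finset.sum_mul_sq_le_sq_mul_sq _ _ _

theorem re_star_dotProduct_le {n : Type*} [Fintype n] (u v : n → ℂ) :
    (star u ⬝ᵥ v).re ≤ ‖WithLp.toLp 2 u‖ * ‖WithLp.toLp 2 v‖ := by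
  have h := re_inner_le_norm (𝕜 := ℂ) (WithLp.toLp 2 u) (WithLp.toLp 2 v)
  rwa [EuclideanSpace.inner_toLp_toLp, dotProduct_comm] at h

theorem star_dotProduct_self_re {n : Type*} [Fintype n] (u : n → ℂ) :
    (star u ⬝ᵥ u).re = ‖WithLp.toLp 2 u‖ ^ 2 := by
  have h := inner_self_eq_norm_sq (𝕜 := ℂ) (WithLp.toLp 2 u)
  rwa [EuclideanSpace.inner_toLp_toLp, dotProduct_comm] at h

/-- The weighted pseudo-inverse `(G* B G)⁻¹ G*`. -/
noncomputable def weightedZF {ι : Type*} [Fintype ι] {K : ℕ} (B : Matrix ι ι ℂ)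
    (G : Matrix ι (Fin K) ℂ) : Matrix (Fin K) ι ℂ :=
  (Gᴴ * B * G)⁻¹ * Gᴴ

/-- `κ ≤ B` in the sense of quadratic forms. -/
def IsQuadLowerBound {ι : Type*} [Fintype ι] (κ : ℝ) (B : Matrix ι ι ℂ) : Prop :=
  ∀ u : ι → ℂ, κ * ‖WithLp.toLp 2 u‖ ^ 2 ≤ (star u ⬝ᵥ (B *ᵥ u)).re

section
variable {ι : Type*} [Fintype ι] {K : ℕ} {B : Matrix ι ι ℂ} {G : Matrix ι (Fin K) ℂ} {κ : ℝ}

theorem isQuadLowerBound_one [DecidableEq ι] : IsQuadLowerBound 1 (1 : Matrix ι ι ℂ) := fun u => by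
  rw [Matrix.one_mulVec, star_dotProduct_self_re, one_mul]

theorem star_mulVec_dotProduct {m n : Type*} [Fintype m] [Fintype n] (G : Matrix m n ℂ)
    (a : n → ℂ) (v : m → ℂ) : star (G *ᵥ a) ⬝ᵥ v = star a ⬝ᵥ (Gᴴ *ᵥ v) := by
  rw [Matrix.star_mulVec, Matrix.dotProduct_mulVec]

theorem isUnit_det_gram_of_injective (hκ : 0 < κ) (hB : IsQuadLowerBound κ B)
    (hG : Function.Injective G.mulVec) : IsUnit (Gᴴ * B * G).det := by
  rw [← Matrix.isUnit_iff_isUnit_det, ← Matrix.mulVec_injective_iff_isUnit]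
  refine (injective_iff_map_eq_zero (Gᴴ * B * G).mulVecLin).2 fun a ha => ?_
  rw [Matrix.mulVecLin_apply] at ha
  have h := hB (G *ᵥ a)
  rw [star_mulVec_dotProduct, Matrix.mulVec_mulVec, Matrix.mulVec_mulVec, ha,
    dotProduct_zero, Complex.zero_re] at h
  have h0 : ‖WithLp.toLp 2 (G *ᵥ a)‖ = 0 := by
    by_contra hne
    have : 0 < ‖WithLp.toLp 2 (G *ᵥ a)‖ := lt_of_le_of_ne (norm_nonneg _) (Ne.symm hne)
    have : 0 < κ * ‖WithLp.toLp 2 (G *ᵥ a)‖ ^ 2 := by positivity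
    linarith
  rw [norm_eq_zero, WithLp.toLp_eq_zero] at h0
  exact hG (h0.trans (Matrix.mulVec_zero G).symm)

theorem gram_mulVec_weightedZF (hdet : IsUnit (Gᴴ * B * G).det) (v : ι → ℂ) :
    (Gᴴ * B * G) *ᵥ (weightedZF B G *ᵥ v) = Gᴴ *ᵥ v := by
  rw [weightedZF, Matrix.mulVec_mulVec, Matrix.mul_nonsing_inv_cancel_left _ _ hdet]

/-- For `a = weightedZF B G *ᵥ v`, `κ‖Ga‖² ≤ Re⟨Ga, BGa⟩ = Re⟨a, G*v⟩ = Re⟨Ga, v⟩ ≤ ‖Ga‖‖v‖`. The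
bound does not involve the conditioning of `G`. -/
theorem norm_mulVec_weightedZF_le (hκ : 0 < κ) (hB : IsQuadLowerBound κ B)
    (hG : Function.Injective G.mulVec) (v : ι → ℂ) :
    ‖WithLp.toLp 2 (G *ᵥ (weightedZF B G *ᵥ v))‖ ≤ ‖WithLp.toLp 2 v‖ / κ := by
  have hgram := gram_mulVec_weightedZF (isUnit_det_gram_of_injective hκ hB hG) v
  generalize weightedZF B G *ᵥ v = a at hgram ⊢
  have h := hB (G *ᵥ a)
  rw [star_mulVec_dotProduct, Matrix.mulVec_mulVec, Matrix.mulVec_mulVec, hgram,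
    ← star_mulVec_dotProduct] at h
  have h2 := h.trans (re_star_dotProduct_le _ _)
  rw [le_div_iff₀ hκ]
  by_contra! hlt
  have hpos : 0 < ‖WithLp.toLp 2 (G *ᵥ a)‖ := by
    by_contra! hle
    have := norm_nonneg (WithLp.toLp 2 v)
    nlinarith
  nlinarith

theorem zfInverse_eq_weightedZF [DecidableEq ι] : zfInverse G = weightedZF 1 G := by
  rw [zfInverse, weightedZF, Matrix.mul_one]

theorem zfInverse_mul_self (hG : Function.Injective G.mulVec) : zfInverse G * G = 1 := by
  classical
  have := isUnit_det_gram_of_injective one_pos isQuadLowerBound_one hG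
  rw [Matrix.mul_one] at this
  rw [zfInverse, Matrix.mul_assoc, Matrix.nonsing_inv_mul _ this]

/-- Inserting `G†G = 1` separates the random factor `‖G†‖_F` from the factor depending on `v` and
`κ`, so that independence can be used later. -/
theorem norm_weightedZF_mulVec_le (hκ : 0 < κ) (hB : IsQuadLowerBound κ B)
    (hG : Function.Injective G.mulVec) (v : ι → ℂ) :
    ‖WithLp.toLp 2 (weightedZF B G *ᵥ v)‖ ≤ frobNorm (zfInverse G) * (‖WithLp.toLp 2 v‖ / κ) := by
  have h : weightedZF B G *ᵥ v = zfInverse G *ᵥ (G *ᵥ (weightedZF B G *ᵥ v)) := by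
    rw [Matrix.mulVec_mulVec (weightedZF B G *ᵥ v), zfInverse_mul_self hG, Matrix.one_mulVec]
  rw [h]
  exact (norm_mulVec_le_frobNorm _ _).trans
    (mul_le_mul_of_nonneg_left (norm_mulVec_weightedZF_le hκ hB hG v) (frobNorm_nonneg _))

/-- Stability of the pseudo-inverse under a change of the weight. -/
theorem norm_weightedZF_mulVec_le_add [DecidableEq ι] (hκ : 0 < κ) (hB : IsQuadLowerBound κ B)
    (hG : Function.Injective G.mulVec) (v : ι → ℂ) :
    ‖WithLp.toLp 2 (weightedZF B G *ᵥ v)‖ ≤ ‖WithLp.toLp 2 (zfInverse G *ᵥ v)‖ +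
      frobNorm (zfInverse G) * (frobNorm (1 - B) * ‖WithLp.toLp 2 v‖ / κ) := by
  have hdet := isUnit_det_gram_of_injective hκ hB hG
  have hdet1 := isUnit_det_gram_of_injective one_pos isQuadLowerBound_one hG
  have h1 : (Gᴴ * G) *ᵥ (zfInverse G *ᵥ v) = Gᴴ *ᵥ v := by
    have := gram_mulVec_weightedZF hdet1 v
    rwa [← zfInverse_eq_weightedZF, Matrix.mul_one] at this
  have hGa : ‖WithLp.toLp 2 (G *ᵥ (zfInverse G *ᵥ v))‖ ≤ ‖WithLp.toLp 2 v‖ := by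
    have := norm_mulVec_weightedZF_le one_pos isQuadLowerBound_one hG v
    rwa [← zfInverse_eq_weightedZF, div_one] at this
  generalize zfInverse G *ᵥ v = a at h1 hGa ⊢
  -- A resolvent identity with `a = G†v`; the correction is small because `‖Ga‖ ≤ ‖v‖`.
  have key : weightedZF B G *ᵥ v = a + weightedZF B G *ᵥ ((1 - B) *ᵥ (G *ᵥ a)) := by
    have hinj : Function.Injective (Gᴴ * B * G).mulVec :=
      Matrix.mulVec_injective_iff_isUnit.2 ((Matrix.isUnit_iff_isUnit_det _).2 hdet)
    refine hinj ?_
    rw [Matrix.mulVec_add, gram_mulVec_weightedZF hdet, gram_mulVec_weightedZF hdet,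
      Matrix.sub_mulVec, Matrix.one_mulVec, Matrix.mulVec_sub, Matrix.mulVec_mulVec a Gᴴ G, h1]
    simp only [Matrix.mulVec_mulVec, Matrix.mul_assoc]
    abel
  rw [key, WithLp.toLp_add]
  refine (norm_add_le _ _).trans (add_le_add le_rfl ?_)
  refine (norm_weightedZF_mulVec_le hκ hB hG _).trans
    (mul_le_mul_of_nonneg_left ?_ (frobNorm_nonneg _))
  gcongr
  exact (norm_mulVec_le_frobNorm _ _).trans
    (mul_le_mul_of_nonneg_left hGa (frobNorm_nonneg _))
end

/-! ### Rows of the pseudo-inverse and column distances. -/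

section
variable {ι : Type*} [Fintype ι] {K : ℕ}

/-- A kernel vector with `a k ≠ 0` expresses column `k` through the others, making its distance
zero. -/
theorem injective_mulVec_of_distSpanOthers_ne_zero {g : Fin K → ι → ℂ}
    (hg : ∀ k, distSpanOthers k g ≠ 0) : Function.Injective ((Matrix.of g)ᵀ).mulVec := by
  refine (injective_iff_map_eq_zero ((Matrix.of g)ᵀ).mulVecLin).2 fun a ha => ?_
  by_contra hne
  obtain ⟨k, hk⟩ := Function.ne_iff.1 hne
  refine hg k (le_antisymm ((iInf_le _ fun j => -(a j / a k)).trans (le_of_eq ?_)) zero_le)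
  rw [enorm_eq_zero, WithLp.toLp_eq_zero]
  have hk : a k ≠ 0 := hk
  ext p
  have hp : ∑ j, g j p * a j = 0 := congrFun ha p
  rw [← Finset.add_sum_erase _ _ (Finset.mem_univ k)] at hp
  simp only [Pi.sub_apply, Finset.sum_apply, Pi.smul_apply, smul_eq_mul, Pi.zero_apply]
  have h2 : ∑ j ∈ Finset.univ.erase k, -(a j / a k) * g j p =
      -(∑ j ∈ Finset.univ.erase k, g j p * a j) / a k := by
    rw [← Finset.sum_neg_distrib, Finset.sum_div]
    exact Finset.sum_congr rfl fun j _ => by ring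
  rw [h2, ← eq_neg_of_add_eq_zero_left hp]
  field_simp
  ring

/-- The norm of a row of the pseudo-inverse is the inverse of the distance of the corresponding
column from the span of the others. -/
theorem enorm_row_zfInverse_le {g : Fin K → ι → ℂ}
    (hG : Function.Injective ((Matrix.of g)ᵀ).mulVec) (k : Fin K) :
    ‖WithLp.toLp 2 (zfInverse (Matrix.of g)ᵀ k)‖ₑ ≤ (distSpanOthers k g)⁻¹ := by
  classical
  set G := (Matrix.of g)ᵀ with hGdef
  set S := (Gᴴ * G)⁻¹ with hS
  set r := WithLp.toLp 2 (zfInverse G k) with hr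
  have hdet : IsUnit (Gᴴ * G).det := by
    have := isUnit_det_gram_of_injective one_pos isQuadLowerBound_one hG
    rwa [Matrix.mul_one] at this
  have hSh : Sᴴ = S := by
    rw [hS, Matrix.conjTranspose_nonsing_inv, Matrix.conjTranspose_mul,
      Matrix.conjTranspose_conjTranspose]
  have hconj : ∀ p, star (zfInverse G k p) = (G * S) p k := by
    intro p
    rw [← Matrix.conjTranspose_apply, zfInverse, Matrix.conjTranspose_mul,
      Matrix.conjTranspose_conjTranspose, ← hS, hSh]
  have hnorm : ((‖r‖ ^ 2 : ℝ) : ℂ) = S k k := by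
    have h1 : (zfInverse G * (G * S)) k k = S k k := by
      rw [← Matrix.mul_assoc, zfInverse_mul_self hG, Matrix.one_mul]
    rw [← h1, Matrix.mul_apply, hr, EuclideanSpace.norm_sq_eq]
    push_cast
    refine Finset.sum_congr rfl fun p _ => ?_
    rw [← hconj, ← Complex.mul_conj']
    rfl
  rcases eq_or_ne r 0 with h0 | h0
  · rw [h0, enorm_zero]; exact zero_le
  have hrpos : ‖r‖ₑ ≠ 0 := by simpa using h0
  have hSk : S k k ≠ 0 := by
    rw [← hnorm]
    exact_mod_cast (pow_ne_zero 2 (norm_ne_zero_iff.2 h0))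
  -- The conjugate of row `k` of `G†` is column `k` of `GS`, a combination of the columns of `G`
  -- with coefficient `S k k = ‖r‖²` at `g k`. Dividing by `S k k` gives a competitor in the
  -- infimum, of norm `1/‖r‖`.
  have hle : ‖r‖ₑ ^ 2 * distSpanOthers k g ≤ ‖r‖ₑ := by
    calc _ ≤ ‖r‖ₑ ^ 2 * ‖WithLp.toLp 2
          (g k - ∑ j ∈ Finset.univ.erase k, (-(S j k / S k k)) • g j)‖ₑ :=
          mul_le_mul_right (iInf_le (fun a : Fin K → ℂ =>
            ‖WithLp.toLp 2 (g k - ∑ j ∈ Finset.univ.erase k, a j • g j)‖ₑ) _) _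
      _ = ‖S k k • WithLp.toLp 2
          (g k - ∑ j ∈ Finset.univ.erase k, (-(S j k / S k k)) • g j)‖ₑ := by
          rw [enorm_smul, ← hnorm]
          congr 1
          rw [← ofReal_norm, ← ofReal_norm, ← ENNReal.ofReal_pow (norm_nonneg _)]
          congr 1
          simp
      _ = ‖r‖ₑ := by
          have hv : S k k • WithLp.toLp 2
              (g k - ∑ j ∈ Finset.univ.erase k, (-(S j k / S k k)) • g j) =
              WithLp.toLp 2 (star (zfInverse G k)) := by
            rw [← WithLp.toLp_smul]
            congr 1
            ext p
            rw [Pi.star_apply, hconj, Matrix.mul_apply,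
              ← Finset.add_sum_erase _ _ (Finset.mem_univ k)]
            simp only [Pi.smul_apply, Pi.sub_apply, Finset.sum_apply, smul_eq_mul, mul_sub,
              Finset.mul_sum]
            rw [sub_eq_add_neg, ← Finset.sum_neg_distrib]
            congr 1
            · exact mul_comm _ _
            · refine Finset.sum_congr rfl fun j _ => ?_
              change _ = g j p * S j k
              field_simp
          rw [hv, ← ofReal_norm, ← ofReal_norm, hr, EuclideanSpace.norm_eq, EuclideanSpace.norm_eq]
          simp
  rw [ENNReal.le_inv_iff_mul_le]
  have hfin : ‖r‖ₑ ≠ ⊤ := enorm_ne_top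
  rw [pow_two, mul_assoc] at hle
  exact (ENNReal.mul_le_mul_iff_right hrpos hfin).1 (by simpa using hle)
end

/-! ### The pseudo-inverse of a Gaussian matrix. -/

theorem lintegral_le_of_lintegral_sq_le {Ω : Type*} [MeasurableSpace Ω] {μ : Measure Ω}
    [IsProbabilityMeasure μ] {f : Ω → ENNReal} (hf : AEMeasurable f μ) {c : ENNReal}
    (h : ∫⁻ ω, f ω ^ 2 ∂μ ≤ c ^ 2) : ∫⁻ ω, f ω ∂μ ≤ c := by
  have h1 := eLpNorm_le_eLpNorm_of_exponent_le (p := 1) (q := 2) (μ := μ) (f := f) (by norm_num)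
    hf.aestronglyMeasurable
  rw [eLpNorm_one_eq_lintegral_enorm, eLpNorm_eq_lintegral_rpow_enorm_toReal (by norm_num)
    (by norm_num)] at h1
  simp only [enorm_eq_self, ENNReal.toReal_ofNat, ENNReal.rpow_ofNat] at h1
  refine h1.trans ?_
  calc _ ≤ (c ^ 2) ^ (1 / 2 : ℝ) := ENNReal.rpow_le_rpow h (by norm_num)
    _ = c := by rw [← ENNReal.rpow_natCast, ← ENNReal.rpow_mul]; norm_num

theorem IsIIDStdComplexGaussian.map_eq {Ω ι : Type*} [MeasurableSpace Ω] {μ : Measure Ω}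
    [Fintype ι] {Z : ι → Ω → ℂ} (h : IsIIDStdComplexGaussian μ Z) :
    AEMeasurable (fun ω i => Z i ω) μ ∧ μ.map (fun ω i => Z i ω) = complexGaussianVector ι := by
  have hm : ∀ i, AEMeasurable (Z i) μ := fun i => (h.law i).aemeasurable
  refine ⟨aemeasurable_pi_lambda _ hm, ?_⟩
  have := h.indep.isProbabilityMeasure
  rw [(iIndepFun_iff_map_fun_eq_pi_map hm).1 h.indep, complexGaussianVector]
  congr 1
  ext1 i
  exact (h.law i).map_eq

/-- Columns come first because the distance estimates integrate out one whole column at a time. -/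
theorem IsIIDStdComplexGaussian.map_columns_eq {Ω ι κ : Type*} [MeasurableSpace Ω] {μ : Measure Ω}
    [Fintype ι] [Fintype κ] {G : Ω → ι → κ → ℂ}
    (h : IsIIDStdComplexGaussian μ (fun (pk : ι × κ) ω => G ω pk.1 pk.2)) :
    AEMeasurable (fun ω k p => G ω p k) μ ∧
      μ.map (fun ω k p => G ω p k) = Measure.pi fun _ : κ => complexGaussianVector ι := by
  have h2 : IsIIDStdComplexGaussian μ (fun (kp : κ × ι) ω => G ω kp.2 kp.1) :=
    ⟨fun kp => h.law kp.swap, h.indep.precomp Prod.swap_injective⟩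
  obtain ⟨hm, hlaw⟩ := h2.map_eq
  have hc : (fun ω k p => G ω p k) =
      MeasurableEquiv.curry κ ι ℂ ∘ fun ω (kp : κ × ι) => G ω kp.2 kp.1 := rfl
  refine ⟨hc ▸ (MeasurableEquiv.measurable _).comp_aemeasurable hm, ?_⟩
  rw [hc, ← AEMeasurable.map_map_of_aemeasurable (by fun_prop) hm, hlaw]
  have := Measure.infinitePi_map_curry (ι := κ) (κ := ι) (fun _ _ => stdComplexGaussian)
  simpa only [complexGaussianVector, Measure.infinitePi_eq_pi] using this

section
variable {ι : Type*} [Fintype ι] {K : ℕ}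

theorem gram_columns_apply (g : Fin K → ι → ℂ) (j k : Fin K) :
    (((Matrix.of g)ᵀ)ᴴ * (Matrix.of g)ᵀ) j k =
      inner ℂ (WithLp.toLp 2 (g j)) (WithLp.toLp 2 (g k)) := by
  rw [EuclideanSpace.inner_toLp_toLp, dotProduct_comm]
  rfl

theorem conjTranspose_columns_mulVec (g : Fin K → ι → ℂ) (v : ι → ℂ) (k : Fin K) :
    (((Matrix.of g)ᵀ)ᴴ *ᵥ v) k = inner ℂ (WithLp.toLp 2 (g k)) (WithLp.toLp 2 v) := by
  rw [EuclideanSpace.inner_toLp_toLp, dotProduct_comm]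
  rfl

/-- `G†v` depends only on the inner products of the columns with each other and with `v`. -/
theorem zfInverse_mulVec_unitary (U : EuclideanSpace ℂ ι ≃ₗᵢ[ℂ] EuclideanSpace ℂ ι)
    (g : Fin K → ι → ℂ) (v : ι → ℂ) :
    zfInverse (Matrix.of fun k => WithLp.ofLp (U (WithLp.toLp 2 (g k))))ᵀ *ᵥ
      WithLp.ofLp (U (WithLp.toLp 2 v)) = zfInverse (Matrix.of g)ᵀ *ᵥ v := by
  rw [zfInverse, zfInverse, ← Matrix.mulVec_mulVec, ← Matrix.mulVec_mulVec]
  congr 1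
  · congr 1
    ext j k
    rw [gram_columns_apply, gram_columns_apply]
    exact U.inner_map_map _ _
  · ext k
    rw [conjTranspose_columns_mulVec, conjTranspose_columns_mulVec]
    exact U.inner_map_map _ _

/-- The inverse is discontinuous at singular Gram matrices, but `det⁻¹ • adjugate` represents it
everywhere, with `0⁻¹ = 0`. -/
theorem measurable_zfInverse_apply (k : Fin K) (p : ι) :
    Measurable fun g : Fin K → ι → ℂ => zfInverse (Matrix.of g)ᵀ k p := by
  have hcont : Continuous fun g : Fin K → ι → ℂ =>
      ((Matrix.of g)ᵀ)ᴴ * (Matrix.of g)ᵀ := by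
    refine continuous_matrix fun j k => ?_
    simp only [Matrix.mul_apply, Matrix.conjTranspose_apply, Matrix.transpose_apply,
      Matrix.of_apply]
    fun_prop
  simp only [zfInverse, Matrix.mul_apply, Matrix.inv_def, Ring.inverse_eq_inv',
    Matrix.smul_apply, smul_eq_mul]
  refine Finset.measurable_sum _ fun j _ => Measurable.mul (Measurable.mul ?_ ?_) ?_
  · exact hcont.matrix_det.measurable.inv
  · exact (hcont.matrix_adjugate.matrix_elem k j).measurable
  · simp only [Matrix.conjTranspose_apply, Matrix.transpose_apply, Matrix.of_apply]
    fun_prop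

theorem measurable_zfInverse_mulVec (v : ι → ℂ) :
    Measurable fun g : Fin K → ι → ℂ => zfInverse (Matrix.of g)ᵀ *ᵥ v := by
  refine measurable_pi_lambda _ fun k => ?_
  simp only [Matrix.mulVec, dotProduct]
  exact Finset.measurable_sum _ fun p _ => (measurable_zfInverse_apply k p).mul_const _

theorem measurable_frobNorm_zfInverse :
    Measurable fun g : Fin K → ι → ℂ => frobNorm (zfInverse (Matrix.of g)ᵀ) := by
  unfold frobNorm
  exact (Finset.measurable_sum _ fun k _ => Finset.measurable_sum _ fun p _ =>
    (measurable_zfInverse_apply k p).norm.pow_const 2).sqrt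

theorem ae_injective_mulVec_columns (hK : K ≤ Fintype.card ι) :
    ∀ᵐ g ∂(Measure.pi fun _ : Fin K => complexGaussianVector ι),
      Function.Injective ((Matrix.of g)ᵀ).mulVec := by
  filter_upwards [ae_distSpanOthers_ne_zero (κ := Fin K) (ι := ι) (by simpa using hK)] with g hg
  exact injective_mulVec_of_distSpanOthers_ne_zero hg

theorem ofReal_frobNorm_sq {m n : Type*} [Fintype m] [Fintype n] (A : Matrix m n ℂ) :
    ENNReal.ofReal (frobNorm A) ^ 2 = ∑ i, ‖WithLp.toLp 2 (A i)‖ₑ ^ 2 := by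
  rw [← ENNReal.ofReal_pow (frobNorm_nonneg _), frobNorm_sq,
    ENNReal.ofReal_sum_of_nonneg fun i _ => by positivity]
  refine Finset.sum_congr rfl fun i _ => ?_
  rw [← ofReal_norm, ← ENNReal.ofReal_pow (norm_nonneg _), EuclideanSpace.norm_sq_eq]

/-- Only the first moment is taken, so that `K = P` is included. -/
theorem lintegral_frobNorm_zfInverse_lt_top (hK : K ≤ Fintype.card ι) :
    ∫⁻ g, ENNReal.ofReal (frobNorm (zfInverse (Matrix.of g)ᵀ))
      ∂(Measure.pi fun _ : Fin K => complexGaussianVector ι) < ⊤ := by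
  have hle : ∫⁻ g, ENNReal.ofReal (frobNorm (zfInverse (Matrix.of g)ᵀ))
      ∂(Measure.pi fun _ : Fin K => complexGaussianVector ι) ≤
      ∫⁻ g, ∑ k, (distSpanOthers k g)⁻¹
        ∂(Measure.pi fun _ : Fin K => complexGaussianVector ι) := by
    refine lintegral_mono_ae ?_
    filter_upwards [ae_injective_mulVec_columns hK] with g hg
    refine le_trans ?_ (Finset.sum_le_sum fun k _ => enorm_row_zfInverse_le hg k)
    refine (ENNReal.pow_right_strictMono two_ne_zero).le_iff_le.1 ?_
    rw [ofReal_frobNorm_sq]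
    exact Finset.sum_sq_le_sq_sum_of_nonneg fun k _ => zero_le
  refine hle.trans_lt ?_
  have hm : ∀ k : Fin K, Measurable fun g : Fin K → ι → ℂ => (distSpanOthers k g)⁻¹ :=
    fun k => (measurable_distSpanOthers k).inv
  rw [lintegral_finsetSum _ fun k _ => hm k]
  refine ENNReal.sum_lt_top.2 fun k _ => ?_
  exact (lintegral_inv_distSpanOthers_le k (by simpa using hK)).trans_lt ENNReal.ofReal_lt_top

theorem lintegral_frobNorm_zfInverse_sq_le (hK : K < Fintype.card ι) :
    ∫⁻ g, ENNReal.ofReal (frobNorm (zfInverse (Matrix.of g)ᵀ)) ^ 2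
      ∂(Measure.pi fun _ : Fin K => complexGaussianVector ι) ≤
      ENNReal.ofReal (K / (Fintype.card ι - K)) := by
  have hle : ∫⁻ g, ENNReal.ofReal (frobNorm (zfInverse (Matrix.of g)ᵀ)) ^ 2
      ∂(Measure.pi fun _ : Fin K => complexGaussianVector ι) ≤
      ∫⁻ g, ∑ k, (distSpanOthers k g ^ 2)⁻¹
        ∂(Measure.pi fun _ : Fin K => complexGaussianVector ι) := by
    refine lintegral_mono_ae ?_
    filter_upwards [ae_injective_mulVec_columns hK.le] with g hg
    rw [ofReal_frobNorm_sq]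
    refine Finset.sum_le_sum fun k _ => ?_
    rw [ENNReal.inv_pow]
    exact pow_le_pow_left' (enorm_row_zfInverse_le hg k) 2
  refine hle.trans ?_
  have hm : ∀ k : Fin K, Measurable fun g : Fin K → ι → ℂ => (distSpanOthers k g ^ 2)⁻¹ :=
    fun k => ((measurable_distSpanOthers k).pow_const 2).inv
  rw [lintegral_finsetSum _ fun k _ => hm k]
  refine (Finset.sum_le_sum fun k _ => lintegral_inv_distSpanOthers_sq_le k
    (by simpa using hK)).trans (le_of_eq ?_)
  have h0 : (0 : ℝ) < Fintype.card ι - K := by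
    rw [sub_pos]; exact_mod_cast hK
  rw [Finset.sum_const, Finset.card_univ, Fintype.card_fin, nsmul_eq_mul,
    ← ENNReal.ofReal_natCast, ← ENNReal.ofReal_mul (by positivity), mul_one_div]

theorem lintegral_zfInverse_mulVec_unitary (U : EuclideanSpace ℂ ι ≃ₗᵢ[ℂ] EuclideanSpace ℂ ι)
    (v : ι → ℂ) :
    ∫⁻ g, ‖WithLp.toLp 2 (zfInverse (Matrix.of g)ᵀ *ᵥ WithLp.ofLp (U (WithLp.toLp 2 v)))‖ₑ ^ 2
      ∂(Measure.pi fun _ : Fin K => complexGaussianVector ι) =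
    ∫⁻ g, ‖WithLp.toLp 2 (zfInverse (Matrix.of g)ᵀ *ᵥ v)‖ₑ ^ 2
      ∂(Measure.pi fun _ : Fin K => complexGaussianVector ι) := by
  have hU := measurePreserving_pi (fun _ : Fin K => complexGaussianVector ι)
    (fun _ : Fin K => complexGaussianVector ι)
    (fun _ : Fin K => complexGaussianVector_map_unitary U)
  rw [← hU.lintegral_comp]
  · simp_rw [zfInverse_mulVec_unitary]
  · have := measurable_zfInverse_mulVec (K := K) (WithLp.ofLp (U (WithLp.toLp 2 v)))
    fun_prop

/-- The mean square of `G† v` depends on `v` only through its norm. -/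
theorem card_mul_lintegral_zfInverse_mulVec_sq (v : ι → ℂ) :
    Fintype.card ι * ∫⁻ g, ‖WithLp.toLp 2 (zfInverse (Matrix.of g)ᵀ *ᵥ v)‖ₑ ^ 2
      ∂(Measure.pi fun _ : Fin K => complexGaussianVector ι) =
    ‖WithLp.toLp 2 v‖ₑ ^ 2 * ∫⁻ g, ENNReal.ofReal (frobNorm (zfInverse (Matrix.of g)ᵀ)) ^ 2
      ∂(Measure.pi fun _ : Fin K => complexGaussianVector ι) := by
  classical
  have hp : ∀ p, ∫⁻ g, ‖WithLp.toLp 2 (zfInverse (Matrix.of g)ᵀ *ᵥ v)‖ₑ ^ 2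
      ∂(Measure.pi fun _ : Fin K => complexGaussianVector ι) =
      ‖WithLp.toLp 2 v‖ₑ ^ 2 * ∫⁻ g, ∑ k, ‖zfInverse (Matrix.of g)ᵀ k p‖ₑ ^ 2
        ∂(Measure.pi fun _ : Fin K => complexGaussianVector ι) := by
    intro p
    rcases eq_or_ne v 0 with rfl | hv
    · simp
    have hv0 : ‖WithLp.toLp 2 v‖ ≠ 0 := by simpa using hv
    -- A basis with `v/‖v‖` in position `p` gives a unitary map taking `‖v‖ e_p` to `v`. So `G†v`
    -- has the mean square of `‖v‖` times column `p` of `G†`; summing over all `p` produces the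
    -- Frobenius norm.
    obtain ⟨b, hb⟩ := Orthonormal.exists_orthonormalBasis_extension_of_card_eq (𝕜 := ℂ)
      (E := EuclideanSpace ℂ ι) (ι := ι) (by simp)
      (v := fun _ => ((‖WithLp.toLp 2 v‖ : ℂ))⁻¹ • WithLp.toLp 2 v) (s := {p}) (by
        refine ⟨fun i => ?_, fun i j hij => (hij (Subsingleton.elim i j)).elim⟩
        simp [Set.domRestrict, norm_smul, hv0])
    have hU : WithLp.ofLp (b.repr.symm (WithLp.toLp 2
        ((‖WithLp.toLp 2 v‖ : ℂ) • Pi.single p 1))) = v := by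
      rw [WithLp.toLp_smul, map_smul]
      have : WithLp.toLp 2 (Pi.single p (1 : ℂ)) = EuclideanSpace.single p (1 : ℂ) := rfl
      rw [this, b.repr_symm_single, hb p rfl, smul_inv_smul₀ (by exact_mod_cast hv0)]
    have h := lintegral_zfInverse_mulVec_unitary (K := K) b.repr.symm
      ((‖WithLp.toLp 2 v‖ : ℂ) • Pi.single p 1)
    rw [hU] at h
    rw [h, ← lintegral_const_mul _ (Finset.measurable_sum _ fun k _ =>
      (measurable_zfInverse_apply k p).enorm.pow_const 2)]
    refine lintegral_congr fun g => ?_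
    rw [Matrix.mulVec_smul, WithLp.toLp_smul, enorm_smul, mul_pow, Matrix.mulVec_single_one]
    congr 1
    · rw [← ofReal_norm, ← ofReal_norm]; simp
    · rw [← ofReal_norm, ← ENNReal.ofReal_pow (norm_nonneg _), EuclideanSpace.norm_sq_eq,
        ENNReal.ofReal_sum_of_nonneg fun i _ => by positivity]
      refine Finset.sum_congr rfl fun k _ => ?_
      rw [ENNReal.ofReal_pow (norm_nonneg _), ofReal_norm]
      rfl
  calc _ = ∑ p : ι, ∫⁻ g, ‖WithLp.toLp 2 (zfInverse (Matrix.of g)ᵀ *ᵥ v)‖ₑ ^ 2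
      ∂(Measure.pi fun _ : Fin K => complexGaussianVector ι) := by
        rw [Finset.sum_const, Finset.card_univ, nsmul_eq_mul]
    _ = _ := by
        rw [Finset.sum_congr rfl fun p _ => hp p, ← Finset.mul_sum, ← lintegral_finsetSum _
          fun p _ => (Finset.measurable_sum _ fun k _ =>
            (measurable_zfInverse_apply k p).enorm.pow_const 2)]
        congr 1
        refine lintegral_congr fun g => ?_
        rw [Finset.sum_comm, ← ENNReal.ofReal_pow (frobNorm_nonneg _), frobNorm_sq,
          ENNReal.ofReal_sum_of_nonneg fun i _ => by positivity]
        refine Finset.sum_congr rfl fun k _ => ?_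
        rw [ENNReal.ofReal_sum_of_nonneg fun i _ => by positivity]
        refine Finset.sum_congr rfl fun p _ => ?_
        rw [ENNReal.ofReal_pow (norm_nonneg _), ofReal_norm]

/-- Averaging over directions gains a factor `1/√P` over the bound by `‖G†‖_F ‖v‖`; without it the
constant can exceed `1/(√P - √K)`. -/
theorem lintegral_zfInverse_mulVec_le (hK : K < Fintype.card ι) (v : ι → ℂ) :
    ∫⁻ g, ‖WithLp.toLp 2 (zfInverse (Matrix.of g)ᵀ *ᵥ v)‖ₑ
      ∂(Measure.pi fun _ : Fin K => complexGaussianVector ι) ≤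
    ENNReal.ofReal (Real.sqrt (K / (Fintype.card ι * (Fintype.card ι - K))) *
      ‖WithLp.toLp 2 v‖) := by
  have hm := measurable_zfInverse_mulVec (K := K) v
  refine lintegral_le_of_lintegral_sq_le (Measurable.aemeasurable (by fun_prop)) ?_
  have h0 : (0 : ℝ) < Fintype.card ι - K := by
    rw [sub_pos]; exact_mod_cast hK
  have hP : (0 : ℝ) < Fintype.card ι := by exact_mod_cast (Nat.zero_le K).trans_lt hK
  have hP' : (Fintype.card ι : ENNReal) ≠ 0 := by exact_mod_cast hP.ne'
  rw [← ENNReal.mul_le_mul_iff_right hP' (ENNReal.natCast_ne_top _),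
    card_mul_lintegral_zfInverse_mulVec_sq]
  refine (mul_le_mul_right (lintegral_frobNorm_zfInverse_sq_le hK) _).trans (le_of_eq ?_)
  rw [← ofReal_norm, ← ENNReal.ofReal_pow (by positivity), ← ENNReal.ofReal_pow (by positivity),
    ← ENNReal.ofReal_mul (by positivity), ← ENNReal.ofReal_natCast,
    ← ENNReal.ofReal_mul (by positivity), mul_pow, Real.sq_sqrt (by positivity)]
  congr 1
  field_simp
end

/-! ### Exponential sums off a set of limited density. -/

/-- A set of natural numbers below `M` with few pairs at each distance `≤ H` is small. -/
theorem card_le_add_sum_card_filter_shift (S : Finset ℕ) {M H : ℕ} (hH : 0 < H)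
    (hS : S ⊆ Finset.range M) :
    S.card ≤ (M / H + 1) + ∑ h ∈ Finset.Icc 1 H, {m ∈ S | m + h ∈ S}.card := by
  classical
  -- `T` has at most one point in each block of length `H`; every other point of `S` starts a pair
  -- at distance at most `H`.
  set T := {m ∈ S | ∀ h ∈ Finset.Icc 1 H, m + h ∉ S} with hT
  have hTcard : T.card ≤ M / H + 1 := by
    rw [← Finset.card_range (M / H + 1)]
    refine Finset.card_le_card_of_injOn (fun m => m / H) (fun m hm => ?_) ?_
    · have : m < M := Finset.mem_range.1 (hS (Finset.mem_filter.1 hm).1)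
      simpa using Nat.lt_succ_of_le (Nat.div_le_div_right this.le)
    · have key : ∀ m ∈ T, ∀ m' ∈ T, m / H = m' / H → ¬ m < m' := by
        intro m hm m' hm' he hlt
        refine (Finset.mem_filter.1 hm).2 (m' - m) (Finset.mem_Icc.2 ⟨by omega, ?_⟩) ?_
        · have h1 := Nat.div_add_mod m H
          have h2 := Nat.div_add_mod m' H
          have h3 := Nat.mod_lt m' hH
          rw [he] at h1
          omega
        · rw [Nat.add_sub_cancel' hlt.le]
          exact (Finset.mem_filter.1 hm').1
      intro m hm m' hm' he
      exact le_antisymm (not_lt.1 (key m' hm' m hm he.symm)) (not_lt.1 (key m hm m' hm' he))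
  have hsub : S ⊆ T ∪ (Finset.Icc 1 H).biUnion fun h => {m ∈ S | m + h ∈ S} := by
    intro m hm
    by_cases h : ∀ h ∈ Finset.Icc 1 H, m + h ∉ S
    · exact Finset.mem_union_left _ (Finset.mem_filter.2 ⟨hm, h⟩)
    · push Not at h
      obtain ⟨h, hh, hmh⟩ := h
      exact Finset.mem_union_right _
        (Finset.mem_biUnion.2 ⟨h, hh, Finset.mem_filter.2 ⟨hm, hmh⟩⟩)
  exact (Finset.card_le_card hsub).trans ((Finset.card_union_le _ _).trans
    (add_le_add hTcard Finset.card_biUnion_le))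

/-- An exponential sum with a term whose frequency is not rationally related to the others is small
only on a sparse set. -/
theorem exists_card_small_exponential_sum_le {ι : Type*} [DecidableEq ι] {z : ι → ℂ}
    (hz : ∀ q, ‖z q‖ = 1) (p : ι) (Q : Finset ι) (hpQ : p ∉ Q)
    (hQ : ∀ q ∈ Q, ∀ h : ℕ, 1 ≤ h → z p ^ h ≠ z q ^ h) {η : ℝ} (hη : 0 < η) :
    ∃ ε : ℝ, 0 < ε ∧ ∃ M₀ : ℕ, ∀ c : ι → ℂ, c p ≠ 0 → ∀ M : ℕ, M₀ ≤ M →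
      (({m ∈ Finset.range M |
        ‖∑ q ∈ insert p Q, c q * z q ^ m‖ ≤ ε * ‖c p‖}.card : ℕ) : ℝ) ≤ η * M := by
  induction Q using Finset.induction_on generalizing η with
  | empty =>
    refine ⟨1 / 2, by norm_num, 0, fun c hc M _ => ?_⟩
    rw [Finset.filter_false_of_mem]
    · simp only [Finset.card_empty, Nat.cast_zero]; positivity
    · intro m _
      have : 0 < ‖c p‖ := norm_pos_iff.2 hc
      simp [hz]
      linarith
  | insert q₀ Q hq₀ ih =>
    have hpQ' : p ∉ Q := fun h => hpQ (Finset.mem_insert_of_mem h)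
    have hpq₀ : p ≠ q₀ := fun h => hpQ (h ▸ Finset.mem_insert_self _ _)
    -- The budget `ηM` is split in three: `M/H`, the `H` pair counts of at most `ηM/(3H)` each, and
    -- the `+1`, which forces `M₁ > 3/η`.
    obtain ⟨H, hH⟩ := exists_nat_gt (3 / η)
    have hHpos : (0 : ℝ) < H := lt_trans (by positivity) hH
    have hH0 : 0 < H := by exact_mod_cast hHpos
    obtain ⟨ε', hε', M', hM'⟩ := ih hpQ'
      (fun q hq => hQ q (Finset.mem_insert_of_mem hq)) (η := η / (3 * H)) (by positivity)
    obtain ⟨h₀, hh₀, hmin⟩ := Finset.exists_min_image (Finset.Icc 1 H)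
      (fun h => ‖z p ^ h - z q₀ ^ h‖) ⟨1, Finset.mem_Icc.2 ⟨le_rfl, hH0⟩⟩
    set κ := ‖z p ^ h₀ - z q₀ ^ h₀‖ with hκ
    have hκ0 : 0 < κ := norm_pos_iff.2 (sub_ne_zero.2
      (hQ q₀ (Finset.mem_insert_self _ _) h₀ (Finset.mem_Icc.1 hh₀).1))
    obtain ⟨M₁, hM₁⟩ := exists_nat_gt (3 / η)
    refine ⟨ε' * κ / 2, by positivity, max M' M₁, fun c hc M hM => ?_⟩
    set S := {m ∈ Finset.range M |
      ‖∑ q ∈ insert p (insert q₀ Q), c q * z q ^ m‖ ≤ ε' * κ / 2 * ‖c p‖} with hS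
    have hpair : ∀ h ∈ Finset.Icc 1 H, (({m ∈ S | m + h ∈ S}.card : ℕ) : ℝ) ≤ η / (3 * H) * M := by
      intro h hh
      have hκh : κ ≤ ‖z p ^ h - z q₀ ^ h‖ := hmin h hh
      have hne : z p ^ h - z q₀ ^ h ≠ 0 := norm_pos_iff.1 (hκ0.trans_le hκh)
      refine le_trans ?_ (hM' (fun q => c q * (z q ^ h - z q₀ ^ h)) (mul_ne_zero hc hne) M
        (le_of_max_le_left hM))
      refine Nat.cast_le.2 (Finset.card_le_card fun m hm => ?_)
      obtain ⟨hm1, hm2⟩ := Finset.mem_filter.1 hm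
      obtain ⟨hmM, hm1⟩ := Finset.mem_filter.1 hm1
      obtain ⟨-, hm2⟩ := Finset.mem_filter.1 hm2
      refine Finset.mem_filter.2 ⟨hmM, ?_⟩
      -- Twisted differencing: subtracting `z q₀ ^ h` times the value at `m` from the value at `m +
      -- h` eliminates the frequency `q₀`. The coefficient at `p` keeps modulus at least `κ‖c p‖`,
      -- so the induction hypothesis makes such pairs rare.
      have hid : ∑ q ∈ insert p Q, c q * (z q ^ h - z q₀ ^ h) * z q ^ m =
          ∑ q ∈ insert p (insert q₀ Q), c q * z q ^ (m + h) -
            z q₀ ^ h * ∑ q ∈ insert p (insert q₀ Q), c q * z q ^ m := by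
        rw [Finset.mul_sum, ← Finset.sum_sub_distrib, Finset.insert_comm,
          Finset.sum_insert (a := q₀)]
        · rw [pow_add, mul_comm (z q₀ ^ m), mul_left_comm, sub_self, zero_add]
          exact Finset.sum_congr rfl fun q _ => by ring
        · simp [Ne.symm hpq₀, hq₀]
      rw [hid]
      calc _ ≤ ε' * κ / 2 * ‖c p‖ + ε' * κ / 2 * ‖c p‖ := by
            refine (norm_sub_le _ _).trans (add_le_add hm2 ?_)
            rw [norm_mul, norm_pow, hz, one_pow, one_mul]
            exact hm1
        _ = ε' * (‖c p‖ * κ) := by ring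
        _ ≤ _ := by rw [norm_mul]; gcongr
    have hcard := card_le_add_sum_card_filter_shift S hH0 (Finset.filter_subset _ _)
    have hcard' : (S.card : ℝ) ≤ (M / H + 1) + ∑ h ∈ Finset.Icc 1 H, η / (3 * H) * M := by
      calc (S.card : ℝ) ≤ (((M / H : ℕ) : ℝ) + 1) +
            ∑ h ∈ Finset.Icc 1 H, (({m ∈ S | m + h ∈ S}.card : ℕ) : ℝ) := by exact_mod_cast hcard
        _ ≤ _ := add_le_add (add_le_add Nat.cast_div_le le_rfl) (Finset.sum_le_sum hpair)
    rw [Finset.sum_const, Nat.card_Icc, nsmul_eq_mul, Nat.add_sub_cancel] at hcard'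
    have h1 : (H : ℝ) * (η / (3 * H) * M) = η / 3 * M := by field_simp
    have h2 : (M : ℝ) / H ≤ η / 3 * M := by
      rw [div_le_iff₀ hHpos]
      have h3 : 1 ≤ η / 3 * H := by
        rw [div_lt_iff₀ hη] at hH; linarith
      nlinarith [Nat.cast_nonneg (α := ℝ) M]
    have h3 : 1 ≤ η / 3 * M := by
      have : (M₁ : ℝ) ≤ M := by exact_mod_cast le_of_max_le_right hM
      rw [div_lt_iff₀ hη] at hM₁
      nlinarith
    linarith

/-- Only finitely many shifts being involved, the positions whose shifts all avoid a set `N` are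
numerous if `N` is small. -/
theorem card_filter_shift_mem_ge (N : Finset ℕ) (M L : ℕ) :
    M ≤ {m ∈ Finset.range M | ∀ i ∈ Finset.range L, m + i < M ∧ m + i ∉ N}.card +
      L * (N.card + L) := by
  classical
  set S := {m ∈ Finset.range M | ∀ i ∈ Finset.range L, m + i < M ∧ m + i ∉ N}
  -- The added interval `[M, M + L)` accounts for windows that run past the end of the array.
  have hsub : Finset.range M ⊆ S ∪ (Finset.range L).biUnion fun i =>
      {m ∈ Finset.range M | m + i ∈ N ∪ Finset.Ico M (M + L)} := by
    intro m hm
    by_cases h : ∀ i ∈ Finset.range L, m + i < M ∧ m + i ∉ N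
    · exact Finset.mem_union_left _ (Finset.mem_filter.2 ⟨hm, h⟩)
    · push Not at h
      obtain ⟨i, hi, hmi⟩ := h
      refine Finset.mem_union_right _ (Finset.mem_biUnion.2 ⟨i, hi, Finset.mem_filter.2 ⟨hm, ?_⟩⟩)
      have := Finset.mem_range.1 hm
      have := Finset.mem_range.1 hi
      rcases lt_or_ge (m + i) M with hlt | hge
      · exact Finset.mem_union_left _ (hmi hlt)
      · exact Finset.mem_union_right _ (Finset.mem_Ico.2 ⟨hge, by omega⟩)
  have hone : ∀ i ∈ Finset.range L,
      {m ∈ Finset.range M | m + i ∈ N ∪ Finset.Ico M (M + L)}.card ≤ N.card + L := by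
    intro i _
    calc _ ≤ (N ∪ Finset.Ico M (M + L)).card :=
          Finset.card_le_card_of_injOn (fun m => m + i)
            (fun m hm => (Finset.mem_filter.1 hm).2) (fun a _ b _ h => by simpa using h)
      _ ≤ _ := (Finset.card_union_le _ _).trans (by simp)
  calc M = (Finset.range M).card := (Finset.card_range M).symm
    _ ≤ _ := (Finset.card_le_card hsub).trans (Finset.card_union_le _ _)
    _ ≤ _ := by
      refine add_le_add le_rfl (Finset.card_biUnion_le.trans ((Finset.sum_le_sum hone).trans ?_))
      simp

/-- An exponential sum cannot be small in mean square off a set of density less than the inverse of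
the number of frequencies that are rationally related to a given one. -/
theorem exists_mul_le_sum_norm_sq_exponential_sum {ι : Type*} [Fintype ι] {z : ι → ℂ}
    (hz : ∀ q, ‖z q‖ = 1) (hinj : Function.Injective z) (p : ι) {γ : ℝ} (hγ : 0 ≤ γ)
    (hcl : γ * {q | ∃ h : ℕ, 1 ≤ h ∧ z p ^ h = z q ^ h}.ncard < 1) :
    ∃ κ : ℝ, 0 < κ ∧ ∃ M₀ : ℕ, ∀ M : ℕ, M₀ ≤ M → ∀ F : Finset ℕ, (F.card : ℝ) ≤ γ * M →
      ∀ c : ι → ℂ, κ * M * ‖c p‖ ^ 2 ≤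
        ∑ m ∈ Finset.range M \ F, ‖∑ q, c q * z q ^ m‖ ^ 2 := by
  classical
  set A : Finset ι := {q | ∃ h : ℕ, 1 ≤ h ∧ z p ^ h = z q ^ h} with hA
  have hpA : p ∈ A := by simpa [hA] using ⟨1, le_rfl⟩
  have hncard : {q | ∃ h : ℕ, 1 ≤ h ∧ z p ^ h = z q ^ h}.ncard = A.card := by
    rw [← Set.ncard_coe_finset]; congr 1; ext; simp [hA]
  rw [hncard] at hcl
  set L := A.card with hL
  have hL1 : 1 ≤ L := Finset.card_pos.2 ⟨p, hpA⟩
  have hL0 : (0 : ℝ) < L := by exact_mod_cast hL1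
  -- Applied to the shift, `R` kills all frequencies rationally related to `p` except `p` itself.
  -- Its degree is `L - 1`, so it uses windows of `L` consecutive values.
  set R : Polynomial ℂ := ∏ q ∈ A.erase p, (Polynomial.X - Polynomial.C (z q)) with hR
  have hReval : ∀ r, R.eval (z r) = ∑ i ∈ Finset.range L, R.coeff i * z r ^ i := by
    intro r
    refine Polynomial.eval_eq_sum_range' ?_ _
    rw [hR, Polynomial.natDegree_finsetProd_X_sub_C_eq_card, Finset.card_erase_of_mem hpA]
    omega
  have hR0 : ∀ q ∈ A.erase p, R.eval (z q) = 0 := by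
    intro q hq
    rw [hR, Polynomial.eval_prod]
    exact Finset.prod_eq_zero hq (by simp)
  have hRp : R.eval (z p) ≠ 0 := by
    rw [hR, Polynomial.eval_prod]
    refine Finset.prod_ne_zero_iff.2 fun q hq => ?_
    simpa [sub_eq_zero] using fun h => (Finset.ne_of_mem_erase hq).symm (hinj h)
  set a := 1 + ∑ i ∈ Finset.range L, ‖R.coeff i‖ with ha
  have ha0 : 0 < a := by positivity
  have hη : 0 < (1 - γ * L) / 3 := by linarith
  set η := (1 - γ * L) / 3 with hηdef
  obtain ⟨ε₁, hε₁, M₁, hM₁⟩ := exists_card_small_exponential_sum_le hz p Aᶜ (by simpa using hpA)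
    (fun q hq h hh he => (Finset.mem_compl.1 hq) (by simpa [hA] using ⟨h, hh, he⟩)) hη
  have hb0 : 0 < ‖R.eval (z p)‖ := norm_pos_iff.2 hRp
  set ε := ε₁ * ‖R.eval (z p)‖ / a with hε
  have hε0 : 0 < ε := by positivity
  obtain ⟨M₂, hM₂⟩ := exists_nat_gt ((L : ℝ) ^ 2 / η)
  refine ⟨η / L * ε ^ 2, by positivity, max M₁ M₂, fun M hM F hF c => ?_⟩
  rcases eq_or_ne (c p) 0 with hc | hc
  · rw [hc, norm_zero, zero_pow two_ne_zero, mul_zero]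
    positivity
  set B := {m ∈ Finset.range M \ F | ε * ‖c p‖ < ‖∑ q, c q * z q ^ m‖} with hB
  -- Otherwise more than `ηM` windows avoid `F ∪ B`, since `L(γM + ηM/L + L) < (1 - η)M` for large
  -- `M`. At their starting points the filtered sum is small, contradicting the choice of `M₁`.
  have hBcard : η / L * M ≤ B.card := by
    by_contra! hlt
    have hge := card_filter_shift_mem_ge (F ∪ B) M L
    have hsmall := hM₁ (fun q => c q * R.eval (z q)) (mul_ne_zero hc hRp) M
      (le_of_max_le_left hM)
    have hsub : {m ∈ Finset.range M | ∀ i ∈ Finset.range L, m + i < M ∧ m + i ∉ F ∪ B} ⊆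
        {m ∈ Finset.range M | ‖∑ q ∈ insert p Aᶜ, c q * R.eval (z q) * z q ^ m‖ ≤
          ε₁ * ‖c p * R.eval (z p)‖} := by
      intro m hm
      obtain ⟨hmM, hm⟩ := Finset.mem_filter.1 hm
      refine Finset.mem_filter.2 ⟨hmM, ?_⟩
      have hsum : ∑ q ∈ insert p Aᶜ, c q * R.eval (z q) * z q ^ m =
          ∑ i ∈ Finset.range L, R.coeff i * ∑ q, c q * z q ^ (m + i) := by
        rw [Finset.sum_subset (Finset.subset_univ _)]
        · simp_rw [Finset.mul_sum]
          rw [Finset.sum_comm]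
          refine Finset.sum_congr rfl fun q _ => ?_
          rw [hReval, Finset.mul_sum, Finset.sum_mul]
          exact Finset.sum_congr rfl fun i _ => by ring
        · intro q _ hq
          rw [Finset.mem_insert, Finset.mem_compl, not_or, not_not] at hq
          rw [hR0 q (Finset.mem_erase.2 hq), mul_zero, zero_mul]
      rw [hsum]
      calc _ ≤ ∑ i ∈ Finset.range L, ‖R.coeff i‖ * (ε * ‖c p‖) := by
            refine (norm_sum_le _ _).trans (Finset.sum_le_sum fun i hi => ?_)
            rw [norm_mul]
            refine mul_le_mul_of_nonneg_left ?_ (norm_nonneg _)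
            obtain ⟨hlt', hnot⟩ := hm i hi
            rw [Finset.mem_union, not_or] at hnot
            by_contra! hgt
            exact hnot.2 (Finset.mem_filter.2
              ⟨Finset.mem_sdiff.2 ⟨Finset.mem_range.2 hlt', hnot.1⟩, hgt⟩)
        _ = (a - 1) * (ε * ‖c p‖) := by rw [← Finset.sum_mul, ha]; ring
        _ ≤ a * (ε * ‖c p‖) := mul_le_mul_of_nonneg_right (by linarith) (by positivity)
        _ = _ := by rw [hε, norm_mul]; field_simp
    have h1 := (Nat.cast_le (α := ℝ)).2 (Finset.card_le_card hsub)
    have h2 : ((F ∪ B).card : ℝ) ≤ F.card + B.card := by exact_mod_cast Finset.card_union_le _ _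
    have h3 := (Nat.cast_le (α := ℝ)).2 hge
    push_cast at h3
    have h4 : (L : ℝ) * (((F ∪ B).card : ℝ) + L) ≤ L * (γ * M + η / L * M + L) :=
      mul_le_mul_of_nonneg_left (by linarith) hL0.le
    have h5 : (L : ℝ) * (γ * M + η / L * M + L) = γ * L * M + η * M + L ^ 2 := by field_simp
    have h6 : (L : ℝ) ^ 2 < η * M := by
      have : (M₂ : ℝ) ≤ M := by exact_mod_cast le_of_max_le_right hM
      rw [div_lt_iff₀ hη] at hM₂
      nlinarith
    have h7 : γ * L = 1 - 3 * η := by rw [hηdef]; ring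
    rw [h7] at h5
    nlinarith
  calc _ = η / L * M * (ε * ‖c p‖) ^ 2 := by ring
    _ ≤ B.card * (ε * ‖c p‖) ^ 2 := mul_le_mul_of_nonneg_right hBcard (sq_nonneg _)
    _ = ∑ m ∈ B, (ε * ‖c p‖) ^ 2 := by rw [Finset.sum_const, nsmul_eq_mul]
    _ ≤ ∑ m ∈ B, ‖∑ q, c q * z q ^ m‖ ^ 2 := Finset.sum_le_sum fun m hm =>
        pow_le_pow_left₀ (by positivity) (Finset.mem_filter.1 hm).2.le 2
    _ ≤ _ := Finset.sum_le_sum_of_subset_of_nonneg (Finset.filter_subset _ _)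
        fun _ _ _ => by positivity

/-! ### Gram matrices of steering vectors. -/

/-- The phase shift between neighbouring antennas for a wave of angle of arrival `φ`. -/
noncomputable def steeringPhase (D lam φ : ℝ) : ℂ :=
  Complex.exp (((-(2 * Real.pi * (D / lam * Real.sin φ)) : ℝ) : ℂ) * Complex.I)

theorem norm_steeringPhase (D lam φ : ℝ) : ‖steeringPhase D lam φ‖ = 1 :=
  Complex.norm_exp_ofReal_mul_I _

theorem steeringMatrix_apply (D lam : ℝ) {P : ℕ} (θ : Fin P → ℝ) (M : ℕ) (m : Fin M) (p : Fin P) :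
    steeringMatrix D lam θ M m p = steeringPhase D lam (θ p) ^ (m : ℕ) := by
  rw [steeringMatrix, Matrix.of_apply, steeringPhase, ← Complex.exp_nat_mul]
  congr 1
  push_cast
  ring

theorem norm_steeringMatrix_apply (D lam : ℝ) {P : ℕ} (θ : Fin P → ℝ) (M : ℕ) (m : Fin M)
    (p : Fin P) : ‖steeringMatrix D lam θ M m p‖ = 1 := by
  rw [steeringMatrix_apply, norm_pow, norm_steeringPhase, one_pow]

theorem exists_int_of_steeringPhase_pow_eq {D lam φ ψ : ℝ} {h : ℕ}
    (heq : steeringPhase D lam φ ^ h = steeringPhase D lam ψ ^ h) :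
    ∃ n : ℤ, h * (D / lam * (Real.sin φ - Real.sin ψ)) = n := by
  rw [steeringPhase, steeringPhase, ← Complex.exp_nat_mul, ← Complex.exp_nat_mul,
    Complex.exp_eq_exp_iff_exists_int] at heq
  obtain ⟨n, hn⟩ := heq
  refine ⟨-n, ?_⟩
  have him := congrArg Complex.im hn
  simp only [Complex.add_im, Complex.mul_im, Complex.mul_re, Complex.natCast_re,
    Complex.natCast_im, Complex.ofReal_re, Complex.ofReal_im, Complex.I_re, Complex.I_im,
    Complex.intCast_re, Complex.intCast_im, Complex.re_ofNat, Complex.im_ofNat] at him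
  have hpi : (2 * Real.pi) ≠ 0 := by positivity
  refine mul_left_cancel₀ hpi ?_
  push_cast
  linarith

section
variable {D lam : ℝ} {P : ℕ} {θ : Fin P → ℝ}

theorem steeringPhase_injective
    (hsep : ∀ p q, p ≠ q → ∀ z : ℤ, D / lam * (Real.sin (θ p) - Real.sin (θ q)) ≠ z) :
    Function.Injective fun p => steeringPhase D lam (θ p) := by
  intro p q hpq
  by_contra hne
  obtain ⟨n, hn⟩ := exists_int_of_steeringPhase_pow_eq (h := 1)
    (show steeringPhase D lam (θ p) ^ 1 = steeringPhase D lam (θ q) ^ 1 by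
      rw [pow_one, pow_one]; exact hpq)
  exact hsep p q hne n (by simpa using hn)

theorem setOf_steeringPhase_pow_eq_subset_aliasClass (p : Fin P) :
    {q | ∃ h : ℕ, 1 ≤ h ∧ steeringPhase D lam (θ p) ^ h = steeringPhase D lam (θ q) ^ h} ⊆
      aliasClass D lam θ p := by
  rintro q ⟨h, hh, heq⟩
  obtain ⟨n, hn⟩ := exists_int_of_steeringPhase_pow_eq heq
  have h0 : (h : ℝ) ≠ 0 := by exact_mod_cast (by omega : h ≠ 0)
  refine ⟨n / h, ?_⟩
  push_cast
  rw [← hn]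
  field_simp

theorem re_star_dotProduct_gram {m n : Type*} [Fintype m] [Fintype n] (A : Matrix m n ℂ)
    (u : n → ℂ) : (star u ⬝ᵥ ((Aᴴ * A) *ᵥ u)).re = ‖WithLp.toLp 2 (A *ᵥ u)‖ ^ 2 := by
  rw [← Matrix.mulVec_mulVec, ← star_mulVec_dotProduct, star_dotProduct_self_re]

theorem norm_sq_removeRows_steeringMatrix_mulVec {M : ℕ} (F : Finset (Fin M)) (u : Fin P → ℂ) :
    ‖WithLp.toLp 2 (removeRows F (steeringMatrix D lam θ M) *ᵥ u)‖ ^ 2 =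
      ∑ m ∈ Finset.range M \ F.map Fin.valEmbedding,
        ‖∑ q, u q * steeringPhase D lam (θ q) ^ m‖ ^ 2 := by
  rw [EuclideanSpace.norm_sq_eq]
  have h1 : ∀ m : {m : Fin M // m ∉ F}, (removeRows F (steeringMatrix D lam θ M) *ᵥ u) m =
      ∑ q, u q * steeringPhase D lam (θ q) ^ ((m : Fin M) : ℕ) := by
    intro m
    simp only [removeRows, Matrix.mulVec, dotProduct, Matrix.submatrix_apply,
      steeringMatrix_apply, id]
    exact Finset.sum_congr rfl fun q _ => mul_comm _ _
  simp only [h1]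
  rw [← Finset.sum_subtype (p := fun m => m ∉ F) (Finset.univ \ F) (by simp)
    (fun m : Fin M => ‖∑ q, u q * steeringPhase D lam (θ q) ^ (m : ℕ)‖ ^ 2)]
  refine Finset.sum_nbij (fun m : Fin M => (m : ℕ)) ?_ ?_ ?_ ?_
  · intro m hm
    simp only [Finset.mem_sdiff, Finset.mem_univ, true_and] at hm
    simp only [Finset.mem_sdiff, Finset.mem_range, m.2, true_and, Finset.mem_map,
      Fin.valEmbedding_apply, not_exists, not_and]
    intro a ha he
    exact hm (Fin.ext he ▸ ha)
  · exact fun _ _ _ _ h => Fin.ext h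
  · intro m hm
    simp only [Finset.coe_sdiff, Set.mem_sdiff, Finset.mem_coe, Finset.mem_range, Finset.mem_map,
      Fin.valEmbedding_apply, not_exists, not_and] at hm
    exact ⟨⟨m, hm.1⟩, by simpa using fun ha => hm.2 _ ha rfl, rfl⟩
  · exact fun _ _ => rfl

/-- The Gram matrix of the surviving antennas grows linearly if not too many of them fail. -/
theorem eventually_isQuadLowerBound_of_aliasClass {γ : ℝ} (hγ : 0 ≤ γ)
    (hsep : ∀ p q, p ≠ q → ∀ z : ℤ, D / lam * (Real.sin (θ p) - Real.sin (θ q)) ≠ z)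
    (hcl : ∀ p, γ * (aliasClass D lam θ p).ncard < 1)
    (F : (M : ℕ) → Finset (Fin M)) (hF : ∀ M : ℕ, ((F M).card : ℝ) ≤ γ * M) :
    ∃ κ : ℝ, 0 < κ ∧ ∀ᶠ M : ℕ in atTop, IsQuadLowerBound (κ * M)
      ((removeRows (F M) (steeringMatrix D lam θ M))ᴴ *
        removeRows (F M) (steeringMatrix D lam θ M)) := by
  have hp : ∀ p, ∃ κ : ℝ, 0 < κ ∧ ∃ M₀ : ℕ, ∀ M : ℕ, M₀ ≤ M → ∀ u : Fin P → ℂ,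
      κ * M * ‖u p‖ ^ 2 ≤
        ‖WithLp.toLp 2 (removeRows (F M) (steeringMatrix D lam θ M) *ᵥ u)‖ ^ 2 := by
    intro p
    obtain ⟨κ, hκ, M₀, h⟩ := exists_mul_le_sum_norm_sq_exponential_sum
      (fun q => norm_steeringPhase D lam (θ q)) (steeringPhase_injective hsep) p hγ
      (lt_of_le_of_lt (mul_le_mul_of_nonneg_left (Nat.cast_le.2 (Set.ncard_le_ncard
        (setOf_steeringPhase_pow_eq_subset_aliasClass p) (Set.toFinite _))) hγ) (hcl p))
    refine ⟨κ, hκ, M₀, fun M hM u => ?_⟩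
    rw [norm_sq_removeRows_steeringMatrix_mulVec]
    exact h M hM _ (by simpa using hF M) u
  choose κ hκ M₀ h using hp
  rcases isEmpty_or_nonempty (Fin P) with hP | hP
  · refine ⟨1, one_pos, Eventually.of_forall fun M u => ?_⟩
    simp [Subsingleton.elim u 0]
  obtain ⟨p₀, -, hp₀⟩ := Finset.exists_min_image Finset.univ κ Finset.univ_nonempty
  have hP0 : (0 : ℝ) < P := by exact_mod_cast Fin.pos_iff_nonempty.2 hP
  -- Each coordinate of `u` is controlled separately; the smallest constant serves all, and
  -- averaging the `P` bounds costs the factor `1/P`.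
  refine ⟨κ p₀ / P, div_pos (hκ p₀) hP0, ?_⟩
  filter_upwards [eventually_ge_atTop (Finset.univ.sup M₀)] with M hM u
  rw [re_star_dotProduct_gram, EuclideanSpace.norm_sq_eq, Finset.mul_sum]
  calc _ ≤ ∑ p : Fin P, (1 / P : ℝ) *
        ‖WithLp.toLp 2 (removeRows (F M) (steeringMatrix D lam θ M) *ᵥ u)‖ ^ 2 := by
        refine Finset.sum_le_sum fun p _ => ?_
        have h1 := h p M ((Finset.le_sup (Finset.mem_univ p)).trans hM) u
        have h2 : κ p₀ * M * ‖u p‖ ^ 2 ≤ κ p * M * ‖u p‖ ^ 2 := by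
          have := hp₀ p (Finset.mem_univ p)
          gcongr
        calc _ = (1 / P : ℝ) * (κ p₀ * M * ‖u p‖ ^ 2) := by ring
          _ ≤ _ := mul_le_mul_of_nonneg_left (h2.trans h1) (by positivity)
    _ = _ := by
        rw [Finset.sum_const, Finset.card_univ, Fintype.card_fin, nsmul_eq_mul]
        field_simp

theorem tendsto_frobNorm_one_sub {α : Type*} {l : Filter α} {n : Type*} [Fintype n]
    [DecidableEq n] {B : α → Matrix n n ℂ} (hB : Tendsto B l (𝓝 1)) :
    Tendsto (fun a => frobNorm (1 - B a)) l (𝓝 0) := by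
  have hcont : Continuous fun C : Matrix n n ℂ => frobNorm (1 - C) := by
    unfold frobNorm
    refine Real.continuous_sqrt.comp (continuous_finsetSum _ fun i _ =>
      continuous_finsetSum _ fun j _ => ?_)
    have : Continuous fun C : Matrix n n ℂ => (1 - C) i j :=
      (continuous_const.sub continuous_id).matrix_elem i j
    fun_prop
  have h := (hcont.tendsto 1).comp hB
  simpa [frobNorm, Function.comp_def] using h

theorem isQuadLowerBound_of_frobNorm_one_sub_le {n : Type*} [Fintype n] [DecidableEq n]
    {B : Matrix n n ℂ} {δ : ℝ} (hB : frobNorm (1 - B) ≤ δ) : IsQuadLowerBound (1 - δ) B := by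
  intro u
  have h1 : (star u ⬝ᵥ (B *ᵥ u)).re =
      ‖WithLp.toLp 2 u‖ ^ 2 - (star u ⬝ᵥ ((1 - B) *ᵥ u)).re := by
    rw [Matrix.sub_mulVec, Matrix.one_mulVec, dotProduct_sub, Complex.sub_re,
      star_dotProduct_self_re]
    ring
  have h2 := re_star_dotProduct_le u ((1 - B) *ᵥ u)
  have h3 := norm_mulVec_le_frobNorm (1 - B) u
  have h4 : frobNorm (1 - B) * ‖WithLp.toLp 2 u‖ ≤ δ * ‖WithLp.toLp 2 u‖ :=
    mul_le_mul_of_nonneg_right hB (norm_nonneg _)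
  have h5 := mul_le_mul_of_nonneg_left (h3.trans h4) (norm_nonneg (WithLp.toLp 2 u))
  rw [h1]
  nlinarith

theorem IsQuadLowerBound.smul {n : Type*} [Fintype n] {B : Matrix n n ℂ} {κ c : ℝ} (hc : 0 ≤ c)
    (hB : IsQuadLowerBound κ B) : IsQuadLowerBound (c * κ) ((c : ℂ) • B) := by
  intro u
  rw [Matrix.smul_mulVec, dotProduct_smul, smul_eq_mul, Complex.re_ofReal_mul, mul_assoc]
  exact mul_le_mul_of_nonneg_left (hB u) hc

theorem IsQuadLowerBound.mono {n : Type*} [Fintype n] {B : Matrix n n ℂ} {κ κ' : ℝ} (h : κ' ≤ κ)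
    (hB : IsQuadLowerBound κ B) : IsQuadLowerBound κ' B := fun u =>
  (mul_le_mul_of_nonneg_right h (sq_nonneg _)).trans (hB u)

theorem eventually_isQuadLowerBound_of_survivors {γ : ℝ} (hγ : γ < 1)
    (F : (M : ℕ) → Finset (Fin M)) (hF : ∀ M : ℕ, ((F M).card : ℝ) ≤ γ * M)
    (h : SurvivorsAsymptoticallyOrthogonal D lam θ F) :
    ∃ κ : ℝ, 0 < κ ∧ ∀ᶠ M : ℕ in atTop, IsQuadLowerBound (κ * M)
      ((removeRows (F M) (steeringMatrix D lam θ M))ᴴ *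
        removeRows (F M) (steeringMatrix D lam θ M)) := by
  refine ⟨(1 - γ) / 2, by linarith, ?_⟩
  filter_upwards [(tendsto_frobNorm_one_sub h).eventually_le_const (u := 1 / 2) (by norm_num),
    eventually_gt_atTop 0] with M hM hM0
  have hM0' : (0 : ℝ) < M := by exact_mod_cast hM0
  -- Orthogonality is normalised by the number of survivors, which is at least `(1 - γ)M`; the
  -- factor `1/2` comes from the distance to the identity.
  have hN : (1 - γ) * M ≤ M - (F M).card := by linarith [hF M]
  have hN0 : 0 < (M - (F M).card : ℝ) := lt_of_lt_of_le (mul_pos (by linarith) hM0') hN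
  have h1 := (isQuadLowerBound_of_frobNorm_one_sub_le hM).smul hN0.le
  rw [← Complex.ofReal_inv, smul_smul, ← Complex.ofReal_mul, mul_inv_cancel₀ hN0.ne',
    Complex.ofReal_one, one_smul] at h1
  exact h1.mono (by linarith)

/-- Off the diagonal the entries are geometric sums with ratio `r ≠ 1` on the unit circle, bounded
by `2/‖r - 1‖` before division by `M`. -/
theorem tendsto_gram_steeringMatrix
    (hsep : ∀ p q, p ≠ q → ∀ z : ℤ, D / lam * (Real.sin (θ p) - Real.sin (θ q)) ≠ z) :
    Tendsto (fun M : ℕ => ((M : ℝ) : ℂ)⁻¹ •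
      ((steeringMatrix D lam θ M)ᴴ * steeringMatrix D lam θ M)) atTop (𝓝 1) := by
  refine tendsto_pi_nhds.2 fun p => tendsto_pi_nhds.2 fun q => ?_
  have hsum : ∀ M : ℕ, ((steeringMatrix D lam θ M)ᴴ * steeringMatrix D lam θ M) p q =
      ∑ m ∈ Finset.range M,
        (conj (steeringPhase D lam (θ p)) * steeringPhase D lam (θ q)) ^ m := by
    intro M
    rw [Matrix.mul_apply, Finset.sum_range]
    refine Finset.sum_congr rfl fun m _ => ?_
    rw [Matrix.conjTranspose_apply, steeringMatrix_apply, steeringMatrix_apply, mul_pow, star_pow]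
    rfl
  have hself : conj (steeringPhase D lam (θ p)) * steeringPhase D lam (θ p) = 1 := by
    rw [Complex.conj_mul', norm_steeringPhase]; norm_num
  simp only [Matrix.smul_apply, hsum, smul_eq_mul]
  rcases eq_or_ne p q with rfl | hpq
  · rw [Matrix.one_apply_eq]
    refine tendsto_const_nhds.congr' ?_
    filter_upwards [eventually_gt_atTop 0] with M hM
    have : (M : ℂ) ≠ 0 := by exact_mod_cast hM.ne'
    simp [hself, this]
  · rw [Matrix.one_apply_ne hpq]
    set r := conj (steeringPhase D lam (θ p)) * steeringPhase D lam (θ q) with hr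
    have hrn : ‖r‖ = 1 := by
      rw [hr, norm_mul, Complex.norm_conj, norm_steeringPhase, norm_steeringPhase, one_mul]
    have hr1 : r ≠ 1 := by
      intro h1
      refine hpq (steeringPhase_injective hsep ?_)
      have hne : conj (steeringPhase D lam (θ p)) ≠ 0 := left_ne_zero_of_mul_eq_one hself
      exact mul_left_cancel₀ hne (hself.trans h1.symm)
    rw [tendsto_zero_iff_norm_tendsto_zero]
    refine squeeze_zero (fun _ => norm_nonneg _) (g := fun M : ℕ => (M : ℝ)⁻¹ * (2 / ‖r - 1‖))
      (fun M => ?_) ?_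
    · rw [norm_mul, norm_inv, Complex.norm_real, Real.norm_natCast, geom_sum_eq hr1, norm_div]
      gcongr
      refine (norm_sub_le _ _).trans ?_
      rw [norm_pow, hrn, one_pow, norm_one]; norm_num
    · simpa using (tendsto_inv_atTop_nhds_zero_nat (𝕜 := ℝ)).mul_const (2 / ‖r - 1‖)
end

/-! ### The detection error for a fixed channel. -/

section
variable {ι m : Type*} [Fintype ι] [Fintype m] {K : ℕ}

theorem weightedZF_smul {B : Matrix ι ι ℂ} {G : Matrix ι (Fin K) ℂ} (hdet : IsUnit (Gᴴ * B * G).det)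
    {c : ℂ} (hc : c ≠ 0) : weightedZF (c • B) G = c⁻¹ • weightedZF B G := by
  rw [weightedZF, weightedZF, Matrix.mul_smul, Matrix.smul_mul]
  have := Matrix.inv_smul' (A := Gᴴ * B * G) (Units.mk0 c hc) hdet
  rw [Units.smul_mk0, Units.smul_def, Units.val_inv_eq_inv_val, Units.val_mk0] at this
  rw [this, Matrix.smul_mul]

theorem weightedZF_mul_mul {B : Matrix ι ι ℂ} {G : Matrix ι (Fin K) ℂ}
    (hdet : IsUnit (Gᴴ * B * G).det) : weightedZF B G * (B * G) = 1 := by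
  rw [weightedZF, Matrix.mul_assoc, ← Matrix.mul_assoc Gᴴ, Matrix.nonsing_inv_mul _ hdet]

/-- The matrix to be inverted involves the array only through its fixed-size Gram matrix. -/
theorem zfInverse_smul_mul {A : Matrix m ι ℂ} {G : Matrix ι (Fin K) ℂ}
    (hdet : IsUnit (Gᴴ * (Aᴴ * A) * G).det) {c : ℝ} (hc : c ≠ 0) :
    zfInverse ((c : ℂ) • (A * G)) = (c : ℂ)⁻¹ • (weightedZF (Aᴴ * A) G * Aᴴ) := by
  have hc' : (c : ℂ) ≠ 0 := by exact_mod_cast hc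
  have hstar : star (c : ℂ) = c := Complex.conj_ofReal c
  have h := weightedZF_smul hdet (mul_ne_zero hc' hc')
  rw [weightedZF, weightedZF, Matrix.mul_smul, Matrix.smul_mul] at h
  rw [zfInverse, Matrix.conjTranspose_smul, hstar, Matrix.smul_mul, Matrix.mul_smul, Matrix.mul_smul, smul_smul,
    Matrix.conjTranspose_mul]
  have e : Gᴴ * Aᴴ * (A * G) = Gᴴ * (Aᴴ * A) * G := by simp only [Matrix.mul_assoc]
  rw [e, ← Matrix.mul_assoc, h, weightedZF, Matrix.smul_mul, smul_smul]
  congr 1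
  field_simp

theorem sub_zfEstimate {ρ : ℝ} (hρ : 0 < ρ) {H : Matrix m (Fin K) ℂ} (hH : zfInverse H * H = 1)
    (x : Fin K → ℂ) (u : m → ℂ) :
    x - zfEstimate ρ H (((Real.sqrt ρ : ℝ) : ℂ) • (H *ᵥ x) + u) =
      -(((Real.sqrt ρ : ℝ) : ℂ)⁻¹ • (zfInverse H *ᵥ u)) := by
  have h0 : ((Real.sqrt ρ : ℝ) : ℂ) ≠ 0 := by exact_mod_cast (Real.sqrt_pos.2 hρ).ne'
  rw [zfEstimate, Matrix.mulVec_add, Matrix.mulVec_smul, Matrix.mulVec_mulVec, hH,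
    Matrix.one_mulVec, smul_add, inv_smul_smul₀ h0]
  abel

/-- The detection error of zero forcing, for a realization of the channel. -/
theorem norm_sub_zfEstimate_le {ρ : ℝ} (hρ : 0 < ρ) {P : ℕ} (hP : 0 < P) {A : Matrix m ι ℂ}
    {G : Matrix ι (Fin K) ℂ} {κ : ℝ} (hκ : 0 < κ) (hA : IsQuadLowerBound κ (Aᴴ * A))
    (hG : Function.Injective G.mulVec) (x : Fin K → ℂ) (u v : m → ℂ) :
    ‖WithLp.toLp 2 (x - zfEstimate ρ (((Real.sqrt P : ℝ) : ℂ)⁻¹ • (A * G))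
      (((Real.sqrt ρ : ℝ) : ℂ) • ((((Real.sqrt P : ℝ) : ℂ)⁻¹ • (A * G)) *ᵥ x) + (u + v)))‖ ≤
    Real.sqrt P / Real.sqrt ρ * (‖WithLp.toLp 2 (weightedZF (Aᴴ * A) G *ᵥ (Aᴴ *ᵥ u))‖ +
      frobNorm (zfInverse G) * (‖WithLp.toLp 2 (Aᴴ *ᵥ v)‖ / κ)) := by
  have hdet := isUnit_det_gram_of_injective hκ hA hG
  have hP0 : (Real.sqrt P)⁻¹ ≠ 0 := inv_ne_zero (Real.sqrt_pos.2 (by exact_mod_cast hP)).ne'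
  have hinv := zfInverse_smul_mul hdet hP0
  rw [Complex.ofReal_inv, inv_inv] at hinv
  have hPc : ((Real.sqrt P : ℝ) : ℂ) ≠ 0 := by exact_mod_cast fun h => hP0 (by rw [h, inv_zero])
  have hone : zfInverse (((Real.sqrt P : ℝ) : ℂ)⁻¹ • (A * G)) *
      (((Real.sqrt P : ℝ) : ℂ)⁻¹ • (A * G)) = 1 := by
    rw [hinv, Matrix.smul_mul, Matrix.mul_smul, smul_inv_smul₀ hPc, Matrix.mul_assoc,
      ← Matrix.mul_assoc Aᴴ, weightedZF_mul_mul hdet]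
  rw [sub_zfEstimate hρ hone, hinv, WithLp.toLp_neg, norm_neg, WithLp.toLp_smul, norm_smul,
    Matrix.smul_mulVec, WithLp.toLp_smul, norm_smul, norm_inv, Complex.norm_real, Complex.norm_real,
    Real.norm_of_nonneg (Real.sqrt_nonneg _), Real.norm_of_nonneg (Real.sqrt_nonneg _), ← mul_assoc,
    inv_mul_eq_div, ← Matrix.mulVec_mulVec, Matrix.mulVec_add, Matrix.mulVec_add, WithLp.toLp_add]
  -- The term in `u` stays exact, since the distortion needs a sharp constant; the noise `v`
  -- tolerates the crude bound.
  refine mul_le_mul_of_nonneg_left ((norm_add_le _ _).trans (add_le_add le_rfl ?_)) (by positivity)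
  exact norm_weightedZF_mulVec_le hκ hA hG _
end

/-! ### The contribution of the noise. -/

/-- The mean modulus of a linear combination of i.i.d. `CN(0,1)` variables. -/
theorem lintegral_enorm_dotProduct_complexGaussianVector {ι : Type*} [Fintype ι] (a : ι → ℂ) :
    ∫⁻ n, ‖star a ⬝ᵥ n‖ₑ ∂(complexGaussianVector ι) =
      ‖WithLp.toLp 2 a‖ₑ * ∫⁻ z, ‖z‖ₑ ∂stdComplexGaussian := by
  rcases eq_or_ne a 0 with rfl | ha
  · simp
  obtain ⟨p, -⟩ := Function.ne_iff.1 ha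
  have hv0 : ‖WithLp.toLp 2 a‖ ≠ 0 := by simpa using ha
  obtain ⟨b, hb⟩ := Orthonormal.exists_orthonormalBasis_extension_of_card_eq (𝕜 := ℂ)
    (E := EuclideanSpace ℂ ι) (ι := ι) (by simp)
    (v := fun _ => ((‖WithLp.toLp 2 a‖ : ℂ))⁻¹ • WithLp.toLp 2 a) (s := {p}) (by
      refine ⟨fun i => ?_, fun i j hij => (hij (Subsingleton.elim i j)).elim⟩
      simp [Set.domRestrict, norm_smul, hv0])
  have ha' : WithLp.toLp 2 a = (‖WithLp.toLp 2 a‖ : ℂ) • b p := by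
    rw [hb p rfl, smul_inv_smul₀ (by exact_mod_cast hv0)]
  have h : ∀ n : ι → ℂ, ‖star a ⬝ᵥ n‖ₑ =
      ‖WithLp.toLp 2 a‖ₑ * ‖b.repr (WithLp.toLp 2 n) p‖ₑ := by
    intro n
    have h1 : star a ⬝ᵥ n = inner ℂ (WithLp.toLp 2 a) (WithLp.toLp 2 n) := by
      rw [EuclideanSpace.inner_toLp_toLp, dotProduct_comm]
    rw [h1, b.repr_apply_apply]
    nth_rw 1 [ha']
    rw [inner_smul_left, enorm_mul, Complex.conj_ofReal, ← ofReal_norm (WithLp.toLp 2 a),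
      ← ofReal_norm ((‖WithLp.toLp 2 a‖ : ℂ)), Complex.norm_real, norm_norm]
  simp_rw [h]
  rw [lintegral_const_mul' _ _ enorm_ne_top,
    (complexGaussianVector_map_unitary b.repr).lintegral_comp (f := fun n : ι → ℂ => ‖n p‖ₑ)
      (by fun_prop)]
  congr 1
  exact (measurePreserving_eval (fun _ : ι => stdComplexGaussian) p).lintegral_comp (by fun_prop)

/-- The mean Frobenius norm of the pseudo-inverse of a `P × K` matrix with i.i.d. `CN(0,1)`
entries. -/
noncomputable def meanFrobNormZF (P K : ℕ) : ENNReal :=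
  ∫⁻ g, ENNReal.ofReal (frobNorm (zfInverse (Matrix.of g)ᵀ))
    ∂(Measure.pi fun _ : Fin K => complexGaussianVector (Fin P))

section
variable {Ω : Type*} [MeasurableSpace Ω] {μ : Measure Ω} {P K : ℕ} {G : Ω → Fin P → Fin K → ℂ}

theorem lintegral_comp_gains
    (hG : IsIIDStdComplexGaussian μ (fun (pk : Fin P × Fin K) ω => G ω pk.1 pk.2))
    {f : (Fin K → Fin P → ℂ) → ENNReal} (hf : Measurable f) :
    ∫⁻ ω, f (fun k p => G ω p k) ∂μ =
      ∫⁻ g, f g ∂(Measure.pi fun _ : Fin K => complexGaussianVector (Fin P)) := by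
  rw [← hG.map_columns_eq.2, lintegral_map' hf.aemeasurable hG.map_columns_eq.1]

theorem lintegral_frobNorm_gains
    (hG : IsIIDStdComplexGaussian μ (fun (pk : Fin P × Fin K) ω => G ω pk.1 pk.2)) :
    ∫⁻ ω, ENNReal.ofReal (frobNorm (zfInverse (Matrix.of (G ω)))) ∂μ = meanFrobNormZF P K :=
  lintegral_comp_gains hG (f := fun g => ENNReal.ofReal (frobNorm (zfInverse (Matrix.of g)ᵀ)))
    measurable_frobNorm_zfInverse.ennreal_ofReal

theorem aemeasurable_frobNorm_gains
    (hG : IsIIDStdComplexGaussian μ (fun (pk : Fin P × Fin K) ω => G ω pk.1 pk.2)) :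
    AEMeasurable (fun ω => ENNReal.ofReal (frobNorm (zfInverse (Matrix.of (G ω))))) μ :=
  (measurable_frobNorm_zfInverse.ennreal_ofReal).comp_aemeasurable hG.map_columns_eq.1

theorem ae_injective_mulVec_gains (hPK : K ≤ P)
    (hG : IsIIDStdComplexGaussian μ (fun (pk : Fin P × Fin K) ω => G ω pk.1 pk.2)) :
    ∀ᵐ ω ∂μ, Function.Injective (Matrix.of (G ω)).mulVec := by
  have h := ae_injective_mulVec_columns (ι := Fin P) (K := K) (by simpa using hPK)
  rw [← hG.map_columns_eq.2] at h
  exact ae_of_ae_map hG.map_columns_eq.1 h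

theorem enorm_toLp_le_sum {m : Type*} [Fintype m] (v : m → ℂ) :
    ‖WithLp.toLp 2 v‖ₑ ≤ ∑ i, ‖v i‖ₑ := by
  refine (ENNReal.pow_right_strictMono two_ne_zero).le_iff_le.1 ?_
  refine le_trans (le_of_eq ?_) (Finset.sum_sq_le_sq_sum_of_nonneg fun i _ => zero_le)
  rw [← ofReal_norm, ← ENNReal.ofReal_pow (norm_nonneg _), EuclideanSpace.norm_sq_eq,
    ENNReal.ofReal_sum_of_nonneg fun i _ => by positivity]
  exact Finset.sum_congr rfl fun i _ => by rw [ENNReal.ofReal_pow (norm_nonneg _), ofReal_norm]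

/-- Each column of `A` has norm `√(card m)`, so each coordinate of `A*n` has that many times the
mean modulus of one `CN(0,1)` variable: of order `√M`, against `M` for the Gram matrix. -/
theorem lintegral_conjTranspose_mulVec_noise_le {m : Type*} [Fintype m] {n : Ω → m → ℂ}
    (hn : IsIIDStdComplexGaussian μ (fun i ω => n ω i)) {A : Matrix m (Fin P) ℂ}
    (hA : ∀ i p, ‖A i p‖ = 1) :
    ∫⁻ ω, ‖WithLp.toLp 2 (Aᴴ *ᵥ n ω)‖ₑ ∂μ ≤ P * (ENNReal.ofReal (Real.sqrt (Fintype.card m)) *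
      ∫⁻ z, ‖z‖ₑ ∂stdComplexGaussian) := by
  have hp : ∀ p, ∫⁻ ω, ‖(Aᴴ *ᵥ n ω) p‖ₑ ∂μ = ENNReal.ofReal (Real.sqrt (Fintype.card m)) *
      ∫⁻ z, ‖z‖ₑ ∂stdComplexGaussian := by
    intro p
    have h1 : ∀ ω, (Aᴴ *ᵥ n ω) p = star (fun i => A i p) ⬝ᵥ n ω := fun ω => rfl
    simp_rw [h1]
    have hm : Measurable fun n : m → ℂ => ‖star (fun i => A i p) ⬝ᵥ n‖ₑ := by
      simp only [dotProduct]; fun_prop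
    rw [← lintegral_map' (f := fun n : m → ℂ => ‖star (fun i => A i p) ⬝ᵥ n‖ₑ) hm.aemeasurable
      hn.map_eq.1, hn.map_eq.2, lintegral_enorm_dotProduct_complexGaussianVector]
    congr 1
    rw [← ofReal_norm, EuclideanSpace.norm_eq]
    simp [hA]
  have hm : ∀ p, AEMeasurable (fun ω => ‖(Aᴴ *ᵥ n ω) p‖ₑ) μ := by
    intro p
    have hm : Measurable fun n : m → ℂ => ‖(Aᴴ *ᵥ n) p‖ₑ := by
      simp only [Matrix.mulVec, dotProduct]; fun_prop
    exact hm.comp_aemeasurable hn.map_eq.1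
  refine (lintegral_mono fun ω => enorm_toLp_le_sum _).trans ?_
  rw [lintegral_finsetSum' _ fun p _ => hm p]
  simp [hp]

/-- The contribution of the noise to the detection error. -/
theorem lintegral_frobNorm_mul_noise_le {m : Type*} [Fintype m] {n : Ω → m → ℂ}
    (hG : IsIIDStdComplexGaussian μ (fun (pk : Fin P × Fin K) ω => G ω pk.1 pk.2))
    (hn : IsIIDStdComplexGaussian μ (fun i ω => n ω i)) (hind : IndepFun G n μ)
    {A : Matrix m (Fin P) ℂ} (hA : ∀ i p, ‖A i p‖ = 1) {κ : ℝ} (hκ : 0 < κ) :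
    ∫⁻ ω, ENNReal.ofReal (frobNorm (zfInverse (Matrix.of (G ω))) *
      (‖WithLp.toLp 2 (Aᴴ *ᵥ n ω)‖ / κ)) ∂μ ≤
    meanFrobNormZF P K * (P * ∫⁻ z, ‖z‖ₑ ∂stdComplexGaussian) *
      ENNReal.ofReal (Real.sqrt (Fintype.card m) / κ) := by
  have hf : Measurable fun g : Fin P → Fin K → ℂ =>
      ENNReal.ofReal (frobNorm (zfInverse (Matrix.of g))) :=
    (measurable_frobNorm_zfInverse.ennreal_ofReal).comp
      (f := fun (g : Fin P → Fin K → ℂ) k p => g p k) (by fun_prop)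
  have hg : Measurable fun n : m → ℂ => ‖WithLp.toLp 2 (Aᴴ *ᵥ n)‖ₑ := by
    have : Measurable fun n : m → ℂ => Aᴴ *ᵥ n := by
      refine measurable_pi_lambda _ fun p => ?_
      simp only [Matrix.mulVec, dotProduct]; fun_prop
    fun_prop
  have hsplit : ∀ ω, ENNReal.ofReal (frobNorm (zfInverse (Matrix.of (G ω))) *
      (‖WithLp.toLp 2 (Aᴴ *ᵥ n ω)‖ / κ)) =
      ENNReal.ofReal κ⁻¹ * (ENNReal.ofReal (frobNorm (zfInverse (Matrix.of (G ω)))) *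
        ‖WithLp.toLp 2 (Aᴴ *ᵥ n ω)‖ₑ) := by
    intro ω
    rw [← ofReal_norm, ← ENNReal.ofReal_mul (frobNorm_nonneg _),
      ← ENNReal.ofReal_mul (by positivity)]
    congr 1
    ring
  have hgn : AEMeasurable (fun ω => ‖WithLp.toLp 2 (Aᴴ *ᵥ n ω)‖ₑ) μ :=
    hg.comp_aemeasurable hn.map_eq.1
  simp_rw [hsplit]
  rw [lintegral_const_mul' _ _ ENNReal.ofReal_ne_top,
    lintegral_mul_eq_lintegral_mul_lintegral_of_indepFun'' (aemeasurable_frobNorm_gains hG)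
      hgn (hind.comp hf hg), lintegral_frobNorm_gains hG]
  refine (mul_le_mul_right (mul_le_mul_right
    (lintegral_conjTranspose_mulVec_noise_le hn hA) _) _).trans (le_of_eq ?_)
  rw [div_eq_mul_inv, ENNReal.ofReal_mul (Real.sqrt_nonneg _)]
  ring
end

/-! ### Detection error bounds for the two receivers. -/

section
variable {Ω : Type*} [MeasurableSpace Ω] {μ : Measure Ω} {P K : ℕ}
  {D lam ρ : ℝ} {θ : Fin P → ℝ} {x : Ω → Fin K → ℂ} {G : Ω → Fin P → Fin K → ℂ}

/-- The distortion vanishes on the retained antennas, so only the noise enters. -/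
theorem modifiedZFError_le (hPK : K ≤ P) (hP : 0 < P) (hρ : 0 < ρ) {M : ℕ} {n : Ω → Fin M → ℂ}
    (hmodel : IsUplink μ x G n) (F : Finset (Fin M)) (w : Fin M → ℂ) (hw : ∀ m ∉ F, w m = 0)
    {κ : ℝ} (hκ : 0 < κ) (hA : IsQuadLowerBound κ ((removeRows F (steeringMatrix D lam θ M))ᴴ *
        removeRows F (steeringMatrix D lam θ M))) :
    modifiedZFError μ D lam ρ θ F x G w n ≤ ENNReal.ofReal (Real.sqrt P / Real.sqrt ρ) *
      (meanFrobNormZF P K * (P * ∫⁻ z, ‖z‖ₑ ∂stdComplexGaussian) *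
        ENNReal.ofReal (Real.sqrt M / κ)) := by
  have hn : IsIIDStdComplexGaussian μ (fun (i : {m : Fin M // m ∉ F}) ω => n ω i.val) :=
    ⟨fun i => hmodel.noise.law i, hmodel.noise.indep.precomp Subtype.val_injective⟩
  have hind : IndepFun G (fun ω (i : {m : Fin M // m ∉ F}) => n ω i.val) μ :=
    hmodel.indep_gains_noise.comp (φ := id)
      (ψ := fun (n : Fin M → ℂ) (i : {m : Fin M // m ∉ F}) => n i.val) measurable_id (by fun_prop)
  have hnoise := lintegral_frobNorm_mul_noise_le hmodel.gains hn hind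
    (A := removeRows F (steeringMatrix D lam θ M))
    (fun i p => norm_steeringMatrix_apply D lam θ M i.val p) hκ
  have hcard : Fintype.card {m : Fin M // m ∉ F} ≤ M :=
    (Fintype.card_subtype_le _).trans (by simp)
  have hle : ENNReal.ofReal (Real.sqrt (Fintype.card {m : Fin M // m ∉ F}) / κ) ≤
      ENNReal.ofReal (Real.sqrt M / κ) := by gcongr
  refine le_trans ?_ (mul_le_mul_right (hnoise.trans (mul_le_mul_right hle _)) _)
  rw [modifiedZFError, detectionError, ← lintegral_const_mul' _ _ ENNReal.ofReal_ne_top]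
  refine lintegral_mono_ae ?_
  filter_upwards [ae_injective_mulVec_gains hPK hmodel.gains] with ω hω
  rw [← ENNReal.ofReal_mul (by positivity), ← ofReal_norm]
  refine ENNReal.ofReal_le_ofReal ?_
  have h := norm_sub_zfEstimate_le hρ hP hκ hA hω (x ω) 0 fun i => n ω i.val
  rw [Matrix.mulVec_zero, Matrix.mulVec_zero, WithLp.toLp_zero, norm_zero, zero_add, zero_add] at h
  have hsig : (fun m : {m : Fin M // m ∉ F} =>
      receivedSignal ρ (channelMatrix D lam θ M (G ω)) (x ω) w (n ω) m.val) =
      ((Real.sqrt ρ : ℝ) : ℂ) • ((((Real.sqrt P : ℝ) : ℂ)⁻¹ •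
        (removeRows F (steeringMatrix D lam θ M) * Matrix.of (G ω))) *ᵥ x ω) +
        fun i : {m : Fin M // m ∉ F} => n ω i.val := by
    ext m
    change _ + w m.val + _ = _ + _
    rw [hw m.val m.2, add_zero]
    rfl
  rw [modifiedZFEstimate, hsig]
  exact h

theorem meanFrobNormZF_ne_top (hPK : K ≤ P) : meanFrobNormZF P K ≠ ⊤ :=
  (lintegral_frobNorm_zfInverse_lt_top (by simpa using hPK)).ne

theorem tendsto_noise_bound (hPK : K ≤ P) (ρ κ : ℝ) :
    Tendsto (fun M : ℕ => ENNReal.ofReal (Real.sqrt P / Real.sqrt ρ) *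
      (meanFrobNormZF P K * (P * ∫⁻ z, ‖z‖ₑ ∂stdComplexGaussian) *
        ENNReal.ofReal (Real.sqrt M / (κ * M)))) atTop (𝓝 0) := by
  have hC : meanFrobNormZF P K * (P * ∫⁻ z, ‖z‖ₑ ∂stdComplexGaussian) ≠ ⊤ :=
    ENNReal.mul_ne_top (meanFrobNormZF_ne_top hPK)
      (ENNReal.mul_ne_top (ENNReal.natCast_ne_top P) lintegral_enorm_stdComplexGaussian_lt_top.ne)
  have h0 : Tendsto (fun M : ℕ => Real.sqrt M / (κ * M)) atTop (𝓝 0) := by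
    have h := ((Real.tendsto_sqrt_atTop.comp
      (tendsto_natCast_atTop_atTop (R := ℝ))).inv_tendsto_atTop).const_mul κ⁻¹
    rw [mul_zero] at h
    refine h.congr fun M => ?_
    simp only [Pi.inv_apply, Function.comp]
    rw [div_mul_eq_div_div_swap, Real.sqrt_div_self, div_eq_inv_mul]
  have h1 := ENNReal.tendsto_ofReal h0
  rw [ENNReal.ofReal_zero] at h1
  have h2 := ENNReal.Tendsto.const_mul (ENNReal.Tendsto.const_mul h1 (Or.inr hC))
    (Or.inr (ENNReal.ofReal_ne_top (r := Real.sqrt P / Real.sqrt ρ)))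
  simpa using h2

theorem tendsto_modifiedZFError (hPK : K ≤ P) (hP : 0 < P) (hρ : 0 < ρ)
    {n : (M : ℕ) → Ω → Fin M → ℂ} (hmodel : ∀ M, IsUplink μ x G (n M))
    (F : (M : ℕ) → Finset (Fin M)) (w : (M : ℕ) → Fin M → ℂ) (hw : ∀ M, ∀ m ∉ F M, w M m = 0)
    (hA : ∃ κ : ℝ, 0 < κ ∧ ∀ᶠ M : ℕ in atTop, IsQuadLowerBound (κ * M)
      ((removeRows (F M) (steeringMatrix D lam θ M))ᴴ *
        removeRows (F M) (steeringMatrix D lam θ M))) :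
    Tendsto (fun M : ℕ => modifiedZFError μ D lam ρ θ (F M) x G (w M) (n M)) atTop (𝓝 0) := by
  obtain ⟨κ, hκ, hA⟩ := hA
  have hlim := tendsto_noise_bound hPK ρ κ
  refine tendsto_of_tendsto_of_tendsto_of_le_of_le' tendsto_const_nhds hlim
    (Eventually.of_forall fun _ => zero_le) ?_
  filter_upwards [hA, eventually_gt_atTop 0] with M hM hM0
  have : (0 : ℝ) < M := by exact_mod_cast hM0
  exact modifiedZFError_le hPK hP hρ (hmodel M) (F M) (w M) (hw M) (by positivity) hM

theorem norm_conjTranspose_steeringMatrix_mulVec_le {M : ℕ} (F : Finset (Fin M)) (w : Fin M → ℂ)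
    (hw : ∀ m ∉ F, w m = 0) :
    ‖WithLp.toLp 2 ((steeringMatrix D lam θ M)ᴴ *ᵥ w)‖ ≤ Real.sqrt P * (F.card * ‖w‖) := by
  have hp : ∀ p, ‖((steeringMatrix D lam θ M)ᴴ *ᵥ w) p‖ ≤ F.card * ‖w‖ := by
    intro p
    calc _ ≤ ∑ m, ‖(steeringMatrix D lam θ M)ᴴ p m * w m‖ := norm_sum_le _ _
      _ = ∑ m, ‖w m‖ := Finset.sum_congr rfl fun m _ => by
          rw [norm_mul, Matrix.conjTranspose_apply, norm_star, norm_steeringMatrix_apply, one_mul]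
      _ = ∑ m ∈ F, ‖w m‖ := (Finset.sum_subset (Finset.subset_univ _) fun m _ hm => by
          rw [hw m hm, norm_zero]).symm
      _ ≤ _ := by
          rw [← nsmul_eq_mul]
          exact Finset.sum_le_card_nsmul _ _ _ fun m _ => norm_le_pi_norm w m
  have h0 : 0 ≤ F.card * ‖w‖ := by positivity
  rw [EuclideanSpace.norm_eq, ← Real.sqrt_sq h0, ← Real.sqrt_mul (Nat.cast_nonneg P)]
  refine Real.sqrt_le_sqrt ?_
  calc _ ≤ ∑ _p : Fin P, (F.card * ‖w‖) ^ 2 :=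
        Finset.sum_le_sum fun p _ => pow_le_pow_left₀ (norm_nonneg _) (hp p) 2
    _ = _ := by simp

/-- The first summand carries the distortion and the deviation of the normalised Gram matrix from
`I`, both linear in `W`; the second is the noise. The `2` in `2δ` and the `1/2` in the noise term
come from the quadratic lower bound `1/2`. -/
theorem zfError_le (hPK : K < P) (hρ : 0 < ρ) {M : ℕ} (hM : 0 < M) {n : Ω → Fin M → ℂ}
    (hmodel : IsUplink μ x G n) (w : Fin M → ℂ) {W δ : ℝ}
    (hW : ‖WithLp.toLp 2 ((steeringMatrix D lam θ M)ᴴ *ᵥ w)‖ ≤ M * W) (hδ2 : δ ≤ 1 / 2)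
    (hδ : frobNorm (1 - ((M : ℝ) : ℂ)⁻¹ •
      ((steeringMatrix D lam θ M)ᴴ * steeringMatrix D lam θ M)) ≤ δ) :
    zfError μ D lam ρ θ x G w n ≤ ENNReal.ofReal (Real.sqrt P / Real.sqrt ρ) *
      (ENNReal.ofReal ((Real.sqrt (K / (P * (P - K))) + 2 * δ * (meanFrobNormZF P K).toReal) * W) +
      meanFrobNormZF P K * (P * ∫⁻ z, ‖z‖ₑ ∂stdComplexGaussian) *
        ENNReal.ofReal (Real.sqrt M / (1 / 2 * M))) := by
  have hM0 : (0 : ℝ) < M := by exact_mod_cast hM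
  have hMc : ((M : ℝ) : ℂ) ≠ 0 := by exact_mod_cast hM.ne'
  have hP : 0 < P := (Nat.zero_le K).trans_lt hPK
  have hδ0 : 0 ≤ δ := (frobNorm_nonneg _).trans hδ
  set A := steeringMatrix D lam θ M with hAdef
  set B := ((M : ℝ) : ℂ)⁻¹ • (Aᴴ * A) with hB
  set v := ((M : ℝ) : ℂ)⁻¹ • (Aᴴ *ᵥ w) with hv
  have hvW : ‖WithLp.toLp 2 v‖ ≤ W := by
    rw [hv, WithLp.toLp_smul, norm_smul, norm_inv, Complex.norm_real, Real.norm_natCast,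
      inv_mul_le_iff₀ hM0]
    exact hW
  have hW0 : 0 ≤ W := (norm_nonneg _).trans hvW
  have hBlow : IsQuadLowerBound (1 / 2) B :=
    (isQuadLowerBound_of_frobNorm_one_sub_le hδ).mono (by linarith)
  have hAB : Aᴴ * A = ((M : ℝ) : ℂ) • B := by rw [hB, smul_inv_smul₀ hMc]
  have hAlow : IsQuadLowerBound (1 / 2 * M) (Aᴴ * A) := by
    rw [hAB, mul_comm]
    exact hBlow.smul hM0.le
  have hκ : (0 : ℝ) < 1 / 2 * M := by positivity
  have hnoise := lintegral_frobNorm_mul_noise_le hmodel.gains hmodel.noise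
    hmodel.indep_gains_noise (A := A) (fun i p => norm_steeringMatrix_apply D lam θ M i p) hκ
  rw [Fintype.card_fin] at hnoise
  have hsignal : ∫⁻ ω, ENNReal.ofReal ‖WithLp.toLp 2 (zfInverse (Matrix.of (G ω)) *ᵥ v)‖ ∂μ ≤
      ENNReal.ofReal (Real.sqrt (K / (P * (P - K))) * W) := by
    have h1 := lintegral_zfInverse_mulVec_le (ι := Fin P) (by simpa using hPK) v
    have hm := measurable_zfInverse_mulVec (K := K) v
    rw [← lintegral_comp_gains hmodel.gains (by fun_prop), Fintype.card_fin] at h1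
    simp_rw [ofReal_norm]
    exact h1.trans (ENNReal.ofReal_le_ofReal (mul_le_mul_of_nonneg_left hvW (Real.sqrt_nonneg _)))
  have hpert : ∫⁻ ω, ENNReal.ofReal (frobNorm (zfInverse (Matrix.of (G ω))) * (2 * δ * W)) ∂μ ≤
      ENNReal.ofReal (2 * δ * (meanFrobNormZF P K).toReal * W) := by
    simp_rw [ENNReal.ofReal_mul (frobNorm_nonneg _)]
    rw [lintegral_mul_const' _ _ ENNReal.ofReal_ne_top, lintegral_frobNorm_gains hmodel.gains,
      ← ENNReal.ofReal_toReal (meanFrobNormZF_ne_top hPK.le),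
      ← ENNReal.ofReal_mul ENNReal.toReal_nonneg, ENNReal.toReal_ofReal ENNReal.toReal_nonneg]
    exact ENNReal.ofReal_le_ofReal (le_of_eq (by ring))
  have hmain : zfError μ D lam ρ θ x G w n ≤ ENNReal.ofReal (Real.sqrt P / Real.sqrt ρ) *
      ∫⁻ ω, ((ENNReal.ofReal ‖WithLp.toLp 2 (zfInverse (Matrix.of (G ω)) *ᵥ v)‖ +
        ENNReal.ofReal (frobNorm (zfInverse (Matrix.of (G ω))) * (2 * δ * W))) +
        ENNReal.ofReal (frobNorm (zfInverse (Matrix.of (G ω))) *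
          (‖WithLp.toLp 2 (Aᴴ *ᵥ n ω)‖ / (1 / 2 * M)))) ∂μ := by
    rw [zfError, detectionError, ← lintegral_const_mul' _ _ ENNReal.ofReal_ne_top]
    refine lintegral_mono_ae ?_
    filter_upwards [ae_injective_mulVec_gains hPK.le hmodel.gains] with ω hω
    have hf0 := frobNorm_nonneg (zfInverse (Matrix.of (G ω)))
    rw [← ENNReal.ofReal_add (norm_nonneg _) (by positivity),
      ← ENNReal.ofReal_add (by positivity) (by positivity),
      ← ENNReal.ofReal_mul (by positivity), ← ofReal_norm]
    refine ENNReal.ofReal_le_ofReal ?_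
    have h := norm_sub_zfEstimate_le hρ hP hκ hAlow hω (x ω) w (n ω)
    rw [← add_assoc] at h
    refine h.trans (mul_le_mul_of_nonneg_left (add_le_add ?_ le_rfl) (by positivity))
    have hdet := isUnit_det_gram_of_injective (by norm_num) hBlow hω
    -- The factor `M` of the Gram matrix is moved onto `A*w`, leaving the normalised weight `B` and
    -- `v`.
    rw [hAB, weightedZF_smul hdet hMc, Matrix.smul_mulVec, ← Matrix.mulVec_smul]
    refine (norm_weightedZF_mulVec_le_add (by norm_num) hBlow hω v).trans
      (add_le_add le_rfl (mul_le_mul_of_nonneg_left ?_ hf0))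
    have := mul_le_mul hδ hvW (norm_nonneg _) hδ0
    linarith
  refine hmain.trans (mul_le_mul_right ?_ _)
  have hm1 : AEMeasurable (fun ω =>
      ENNReal.ofReal ‖WithLp.toLp 2 (zfInverse (Matrix.of (G ω)) *ᵥ v)‖) μ := by
    have hm := measurable_zfInverse_mulVec (K := K) v
    exact (by fun_prop : Measurable fun g : Fin K → Fin P → ℂ =>
      ENNReal.ofReal ‖WithLp.toLp 2 (zfInverse (Matrix.of g)ᵀ *ᵥ v)‖).comp_aemeasurable
        hmodel.gains.map_columns_eq.1
  have hm2 : AEMeasurable (fun ω =>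
      ENNReal.ofReal (frobNorm (zfInverse (Matrix.of (G ω))) * (2 * δ * W))) μ := by
    simp_rw [ENNReal.ofReal_mul (frobNorm_nonneg _)]
    exact (aemeasurable_frobNorm_gains hmodel.gains).mul_const _
  have hm12 : AEMeasurable (fun ω =>
      ENNReal.ofReal ‖WithLp.toLp 2 (zfInverse (Matrix.of (G ω)) *ᵥ v)‖ +
        ENNReal.ofReal (frobNorm (zfInverse (Matrix.of (G ω))) * (2 * δ * W))) μ := hm1.add hm2
  rw [lintegral_add_left' hm12, lintegral_add_left' hm1, add_mul,
    ENNReal.ofReal_add (by positivity) (by positivity)]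
  exact add_le_add (add_le_add hsignal hpert) hnoise
end

/-! ### The constant of the first bound, and the conclusion. -/

/-- With `a = √P`, `b = √K`, squaring reduces this to `b²(a - b) < a²(a + b)`. Strictness leaves
room for the Gram matrix perturbation. -/
theorem sqrt_div_lt_one_div_sqrt_sub_sqrt {K P : ℕ} (hPK : K < P) :
    Real.sqrt (K / (P * (P - K))) < 1 / (Real.sqrt P - Real.sqrt K) := by
  have hK0 : (0 : ℝ) ≤ K := Nat.cast_nonneg K
  have hPK' : (K : ℝ) < P := by exact_mod_cast hPK
  have hab : Real.sqrt K < Real.sqrt P := Real.sqrt_lt_sqrt hK0 hPK'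
  have hb := Real.sqrt_nonneg (K : ℝ)
  have ha : 0 < Real.sqrt P := lt_of_le_of_lt hb hab
  have hK := Real.sq_sqrt hK0
  have hP := Real.sq_sqrt (hK0.trans hPK'.le)
  have hd : 0 < Real.sqrt P - Real.sqrt K := sub_pos.2 hab
  rw [Real.sqrt_lt' (by positivity)]
  generalize Real.sqrt P = a at *
  generalize Real.sqrt K = b at *
  rw [← hK, ← hP, div_pow, one_pow, div_lt_div_iff₀ (by rw [sq_sub_sq]; positivity) (by positivity)]
  have h1 : b ^ 2 * (a - b) < a ^ 2 * (a + b) := by nlinarith [mul_pos ha ha, mul_nonneg hb ha.le]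
  nlinarith

/-- A vector without entries has no detection error. -/
theorem detectionError_fin_zero {Ω : Type*} [MeasurableSpace Ω] (μ : Measure Ω)
    (x xhat : Ω → Fin 0 → ℂ) : detectionError μ x xhat = 0 := by
  have h : ∀ ω, x ω - xhat ω = 0 := fun ω => Subsingleton.elim _ _
  simp [detectionError, h]

theorem mainTheorem4 {Ω : Type*} [MeasurableSpace Ω] (μ : Measure Ω) [IsProbabilityMeasure μ]
    (P K : ℕ) (hPK : K ≤ P) (D lam ρ γ : ℝ) (hD : 0 < D) (hlam : 0 < lam) (hρ : 0 < ρ)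
    (hγ : γ ∈ Set.Icc (0 : ℝ) 1)
    (θ : Fin P → ℝ) (hθ : ∀ p, θ p ∈ Set.Icc (-(Real.pi / 2)) (Real.pi / 2))
    -- the steering vectors of distinct directions are distinct
    (hθ_sep : ∀ p q, p ≠ q → ∀ z : ℤ, D / lam * (Real.sin (θ p) - Real.sin (θ q)) ≠ z)
    (x : Ω → Fin K → ℂ) (G : Ω → Fin P → Fin K → ℂ) (n : (M : ℕ) → Ω → Fin M → ℂ)
    (hmodel : ∀ M, IsUplink μ x G (n M))
    -- faulty antennas and the distortion which they cause
    (F : (M : ℕ) → Finset (Fin M)) (hF : ∀ M : ℕ, ((F M).card : ℝ) ≤ γ * M)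
    (w : (M : ℕ) → Fin M → ℂ) (hw : ∀ M, ∀ m ∉ F M, w M m = 0) :
    (K < P → ∀ ε : ℝ, 0 < ε → ∀ᶠ M : ℕ in atTop,
      zfError μ D lam ρ θ x G (w M) (n M) ≤
        ENNReal.ofReal
          (γ * P * ‖w M‖ / (Real.sqrt ρ * (Real.sqrt P - Real.sqrt K)) + ε)) ∧
    (γ < 1 →
      ((∀ p, γ * (aliasClass D lam θ p).ncard < 1) ∨
        SurvivorsAsymptoticallyOrthogonal D lam θ F) →
      Tendsto (fun M : ℕ => modifiedZFError μ D lam ρ θ (F M) x G (w M) (n M)) atTop (𝓝 0)) := by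

  refine ⟨fun hlt ε hε => ?_, fun hγ1 hcase => ?_⟩
  · have hd : 0 < Real.sqrt P - Real.sqrt K :=
      sub_pos.2 (Real.sqrt_lt_sqrt (Nat.cast_nonneg K) (by exact_mod_cast hlt))
    have hP0 : (0 : ℝ) ≤ P := Nat.cast_nonneg P
    have hδ := tendsto_frobNorm_one_sub (tendsto_gram_steeringMatrix hθ_sep)
    -- The perturbed constant tends to one strictly below the target and does not involve `w`, so
    -- the threshold in `M` is uniform in `‖w M‖`; `ε` is spent on the noise alone.
    have hconst := ((hδ.const_mul 2).mul_const (meanFrobNormZF P K).toReal).const_add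
      (Real.sqrt (K / (P * (P - K))))
    rw [mul_zero, zero_mul, add_zero] at hconst
    filter_upwards [eventually_gt_atTop 0, hδ.eventually_le_const (u := 1 / 2) (by norm_num),
      hconst.eventually_le_const (sqrt_div_lt_one_div_sqrt_sub_sqrt hlt),
      (tendsto_noise_bound hPK ρ (1 / 2)).eventually_le_const
        (ENNReal.ofReal_pos.2 hε)] with M hM hδM hcM hnM
    have hW : ‖WithLp.toLp 2 ((steeringMatrix D lam θ M)ᴴ *ᵥ w M)‖ ≤
        M * (Real.sqrt P * (γ * ‖w M‖)) := by
      refine (norm_conjTranspose_steeringMatrix_mulVec_le (F M) (w M) (hw M)).trans ?_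
      calc _ ≤ Real.sqrt P * (γ * M * ‖w M‖) := by gcongr; exact hF M
        _ = _ := by ring
    refine (zfError_le hlt hρ hM (hmodel M) (w M) hW hδM le_rfl).trans ?_
    rw [mul_add, ← ENNReal.ofReal_mul (by positivity)]
    have hγ0 := hγ.1
    rw [ENNReal.ofReal_add (by positivity) hε.le]
    refine add_le_add (ENNReal.ofReal_le_ofReal ?_) hnM
    calc _ ≤ Real.sqrt P / Real.sqrt ρ * (1 / (Real.sqrt P - Real.sqrt K) *
          (Real.sqrt P * (γ * ‖w M‖))) := by gcongr
      _ = (Real.sqrt P * Real.sqrt P) * γ * ‖w M‖ /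
          (Real.sqrt ρ * (Real.sqrt P - Real.sqrt K)) := by field_simp
      _ = _ := by rw [Real.mul_self_sqrt hP0, mul_comm (P : ℝ) γ]
  -- For `P = 0` the normalisation by `√P` degenerates, but then `K = 0` and there is nothing to
  -- estimate.
  · rcases Nat.eq_zero_or_pos P with rfl | hP
    · obtain rfl := Nat.le_zero.1 hPK
      simp only [modifiedZFError, detectionError_fin_zero]
      exact tendsto_const_nhds
    · refine tendsto_modifiedZFError hPK hP hρ hmodel F w hw ?_
      rcases hcase with h | h
      · exact eventually_isQuadLowerBound_of_aliasClass hγ.1 hθ_sep h F hF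
      · exact eventually_isQuadLowerBound_of_survivors hγ1 F hF h
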